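/- **Theorem.** Let $\mathcal A=\mathbb Z[v,v^{-1}]$, with fraction field $\mathbb Q(v)$, and let $d\ge 0$ be an integer. Put $[r]=\frac{v^r-v^{-r}}{v-v^{-1}}$ and $[m]!=[1][2]\cdots[m]$; for an element $x$ of a $\mathbb Q(v)$-algebra put $x^{(m)}=x^m/[m]!$, and for an invertible element $X$ and $t\in\mathbb N$ put $$\begin{bmatrix}X\\t\end{bmatrix}=\prod_{s=1}^{t}\frac{Xv^{-s+1}-X^{-1}v^{s-1}}{v^s-v^{-s}}.$$ Let $\mathbf U=\mathbf U_v(\mathfrak{gl}_2)$ be the $\mathbb Q(v)$-algebra with generators $e,f,K_1^{\pm1},K_2^{\pm1}$ and relations $K_1K_2=K_2K_1$, $K_iK_i^{-1}=K_i^{-1}K_i=1$, $K_1eK_1^{-1}=ve$, $K_1fK_1^{-1}=v^{-1}f$, $K_2eK_2^{-1}=v^{-1}e$, $K_2fK_2^{-1}=vf$, $ef-fe=\frac{K_1K_2^{-1}-K_1^{-1}K_2}{v-v^{-1}}$. With $K=K_1K_2^{-1}$, it is a bialgebra with $\Delta(e)=e\otimes 1+K\otimes e$, $\Delta(f)=f\otimes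 K^{-1}+1\otimes f$, $\Delta(K_i)=K_i\otimes K_i$ and counit $e,f\mapsto 0$, $K_i\mapsto 1$. It acts on $E=\mathbb Q(v)^2$ by $$e\mapsto\begin{pmatrix}0&1\\0&0\end{pmatrix},\quad f\mapsto\begin{pmatrix}0&0\\1&0\end{pmatrix},\quad K_1\mapsto\begin{pmatrix}v&0\\0&1\end{pmatrix},\quad K_2\mapsto\begin{pmatrix}1&0\\0&v\end{pmatrix},$$ hence, through iterated comultiplication (the counit if $d=0$), on $E^{\otimes d}$; let $\rho_d:\mathbf U\to\operatorname{End}_{\mathbb Q(v)}(E^{\otimes d})$ be this representation. The quantum Schur algebra $S_v(2,d)$ is the image of $\rho_d$. The integral Schur algebra $S_{\mathcal A}(2,d)$ is the image under $\rho_d$ of the $\mathcal A$-subalgebra $\mathbf U_{\mathcal A}$ of $\mathbf U$ generated by all $e^{(m)},f^{(m)}$ $(m\in\mathbb N)$, $K_1^{\pm1}$ and $K_2^{\pm1}$. The images of $e,f,K_1,K_2$ in $S_v(2,d)$ are denoted by the same letters. Then: 1. $S_{\mathcal A}(2,d)$ is the $\mathcal A$-subalgebra of $S_v(2,d)$ generated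 by all $e^{(m)},f^{(m)}$ $(m\in\mathbb N)$ and $K_1^{\pm1}$. It is also the $\mathcal A$-subalgebra generated by all $e^{(m)},f^{(m)}$ $(m\in\mathbb N)$ and $K_2^{\pm1}$. 2. The elements $e^{(a)}\begin{bmatrix}K_1\\b_1\end{bmatrix}\begin{bmatrix}K_2\\b_2\end{bmatrix}f^{(c)}$, for $a,b_1,b_2,c\in\mathbb N$ with $b_1+b_2=d$ and $a+b_1+c\le d$, form an $\mathcal A$-basis of $S_{\mathcal A}(2,d)$. 3. The elements $f^{(a)}\begin{bmatrix}K_1\\b_1\end{bmatrix}\begin{bmatrix}K_2\\b_2\end{bmatrix}e^{(c)}$, for $a,b_1,b_2,c\in\mathbb N$ with $b_1+b_2=d$ and $a+b_2+c\le d$, form an $\mathcal A$-basis of $S_{\mathcal A}(2,d)$. 4. Here $S_v(2,d)$ may be given by either of two presentations. Let $P_1$ be the $\mathbb Q(v)$-algebra generated by $e,f,K_1^{\pm1}$ with relations $K_1K_1^{-1}=K_1^{-1}K_1=1$, $K_1eK_1^{-1}=ve$, $K_1fK_1^{-1}=v^{-1}f$, $ef-fe=\frac{v^{-d}K_1^2-v^dK_1^{-2}}{v-v^{-1}}$,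 $(K_1-1)(K_1-v)\cdots(K_1-v^d)=0$, and put $K_2=v^dK_1^{-1}$ in $P_1$. Let $P_2$ be the $\mathbb Q(v)$-algebra generated by $e,f,K_2^{\pm1}$ with relations $K_2K_2^{-1}=K_2^{-1}K_2=1$, $K_2eK_2^{-1}=v^{-1}e$, $K_2fK_2^{-1}=vf$, $ef-fe=\frac{v^dK_2^{-2}-v^{-d}K_2^2}{v-v^{-1}}$, $(K_2-1)(K_2-v)\cdots(K_2-v^d)=0$, and put $K_1=v^dK_2^{-1}$ in $P_2$. For each $i\in\{1,2\}$ there is an isomorphism of $\mathbb Q(v)$-algebras $P_i\to S_v(2,d)$ that sends $e,f,K_1,K_2$ to $e,f,K_1,K_2$. For $j=1$ and for $j=2$ it maps the $\mathcal A$-subalgebra of $P_i$ generated by all $e^{(m)},f^{(m)}$ and $K_j^{\pm1}$ onto $S_{\mathcal A}(2,d)$. -/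

import Mathlib

open scoped TensorProduct

noncomputable section

namespace QSchur

/-! ### Ground rings and quantum integers -/

/-- The ring `ℤ[v, v⁻¹]`. -/
abbrev LaurentZ : Type := LaurentPolynomial ℤ

/-- The field `ℚ(v)`, as the fraction field of `ℤ[v, v⁻¹]`. -/
def Qv : Type := FractionRing LaurentZ

instance : Field Qv := inferInstanceAs (Field (FractionRing LaurentZ))

instance : Algebra LaurentZ Qv := inferInstanceAs (Algebra LaurentZ (FractionRing LaurentZ))

instance : IsFractionRing LaurentZ Qv :=
  inferInstanceAs (IsFractionRing LaurentZ (FractionRing LaurentZ))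

/-- The indeterminate `v`, as an element of `ℚ(v)`. -/
def v : Qv := algebraMap LaurentZ Qv (LaurentPolynomial.T 1)

theorem v_ne_zero : v ≠ 0 := by
  have h : IsUnit (LaurentPolynomial.T 1 : LaurentZ) := LaurentPolynomial.isUnit_T 1
  exact (h.map (algebraMap LaurentZ Qv)).ne_zero

theorem v_sub_inv_ne_zero : v - v⁻¹ ≠ 0 := by
  intro h
  have h1 : v * v = 1 := by
    have h2 := congrArg (· * v) h
    simpa [sub_mul, inv_mul_cancel₀ v_ne_zero, sub_eq_zero] using h2
  have h3 : (LaurentPolynomial.T 2 : LaurentZ) = LaurentPolynomial.T 0 := by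
    apply IsFractionRing.injective LaurentZ Qv
    rw [LaurentPolynomial.T_zero, map_one, ← h1, v, ← map_mul, ← LaurentPolynomial.T_add]
    norm_num
  have h4 := congrArg LaurentPolynomial.degree h3
  rw [LaurentPolynomial.degree_T, LaurentPolynomial.degree_T] at h4
  exact absurd (WithBot.coe_injective h4) (by norm_num)

/-- `v` as a unit of `ℚ(v)`. -/
def vUnit : Qvˣ := Units.mk0 v v_ne_zero

/-- The quantum integer `[r] = (v ^ r - v ^ (-r)) / (v - v⁻¹)`. -/
def qInt (r : ℤ) : Qv := (v ^ r - v ^ (-r)) / (v - v⁻¹)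

/-- The quantum factorial `[m]! = [1] [2] ⋯ [m]`. -/
def qFact (m : ℕ) : Qv := ∏ i ∈ Finset.range m, qInt ((i : ℤ) + 1)

section Elements

variable {B : Type*} [Ring B] [Algebra Qv B]

/-- The divided power `x ^ (m) = x ^ m / [m]!`. -/
def divPow (x : B) (m : ℕ) : B := (qFact m)⁻¹ • x ^ m

/-- For invertible `X`, the element
`∏_{s = 1}^{t} (X v ^ (-s+1) - X⁻¹ v ^ (s-1)) / (v ^ s - v ^ (-s))`; its factors commute.
The list below runs over `j = s - 1`. -/
def qBinom (X : Bˣ) (t : ℕ) : B :=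
  ((List.range t).map fun j : ℕ =>
    (v ^ ((j : ℤ) + 1) - v ^ (-((j : ℤ) + 1)))⁻¹ •
      (v ^ (-(j : ℤ)) • (X : B) - v ^ (j : ℤ) • ((X⁻¹ : Bˣ) : B))).prod

/-- The `ℤ[v, v⁻¹]`-subalgebra of a `ℚ(v)`-algebra generated by all divided powers of `e` and
of `f` together with `K` and `K⁻¹`. -/
def intForm [Algebra LaurentZ B] [IsScalarTower LaurentZ Qv B] (e f : B) (K : Bˣ) : Subalgebra LaurentZ B :=
  Algebra.adjoin LaurentZ
    (Set.range (divPow e) ∪ Set.range (divPow f) ∪ {(K : B), ((K⁻¹ : Bˣ) : B)})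

end Elements

/-! ### The quantized enveloping algebra of `gl₂` -/

/-- Generators of the quantized enveloping algebra: `Ki'` stands for the inverse of `Ki`. -/
inductive UGen : Type
  | e | f | K1 | K1' | K2 | K2'

open UGen in
/-- Defining relations of the quantized enveloping algebra of `gl₂`. -/
inductive URel : FreeAlgebra Qv UGen → FreeAlgebra Qv UGen → Prop
  | K1_comm_K2 : URel (.ι Qv K1 * .ι Qv K2) (.ι Qv K2 * .ι Qv K1)
  | K1_mul_inv : URel (.ι Qv K1 * .ι Qv K1') 1
  | K1_inv_mul : URel (.ι Qv K1' * .ι Qv K1) 1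
  | K2_mul_inv : URel (.ι Qv K2 * .ι Qv K2') 1
  | K2_inv_mul : URel (.ι Qv K2' * .ι Qv K2) 1
  | K1_e : URel (.ι Qv K1 * .ι Qv e * .ι Qv K1') (v • .ι Qv e)
  | K1_f : URel (.ι Qv K1 * .ι Qv f * .ι Qv K1') (v⁻¹ • .ι Qv f)
  | K2_e : URel (.ι Qv K2 * .ι Qv e * .ι Qv K2') (v⁻¹ • .ι Qv e)
  | K2_f : URel (.ι Qv K2 * .ι Qv f * .ι Qv K2') (v • .ι Qv f)
  | e_f : URel (.ι Qv e * .ι Qv f - .ι Qv f * .ι Qv e)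
      ((v - v⁻¹)⁻¹ • (.ι Qv K1 * .ι Qv K2' - .ι Qv K1' * .ι Qv K2))

/-- The Drinfeld–Jimbo quantized enveloping algebra `U_v(gl₂)` over `ℚ(v)`. -/
abbrev Uq : Type := RingQuot URel

namespace Uq

/-- The image of a generator in `U`. -/
def gen (x : UGen) : Uq := RingQuot.mkAlgHom Qv URel (FreeAlgebra.ι Qv x)

theorem rel {x y : FreeAlgebra Qv UGen} (h : URel x y) :
    RingQuot.mkAlgHom Qv URel x = RingQuot.mkAlgHom Qv URel y :=
  RingQuot.mkAlgHom_rel Qv h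

/-- The generator `e`. -/
def e : Uq := gen .e
/-- The generator `f`. -/
def f : Uq := gen .f

/-- The invertible generator `K₁`. -/
def K1 : Uqˣ where
  val := gen .K1
  inv := gen .K1'
  val_inv := by simpa [gen] using rel .K1_mul_inv
  inv_val := by simpa [gen] using rel .K1_inv_mul

/-- The invertible generator `K₂`. -/
def K2 : Uqˣ where
  val := gen .K2
  inv := gen .K2'
  val_inv := by simpa [gen] using rel .K2_mul_inv
  inv_val := by simpa [gen] using rel .K2_inv_mul

/-- `U_A`: the `ℤ[v, v⁻¹]`-subalgebra of `U` generated by all divided powers of `e` and `f`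
and by `K₁`, `K₁⁻¹`, `K₂`, `K₂⁻¹`. -/
def UA : Subalgebra LaurentZ Uq :=
  Algebra.adjoin LaurentZ
    (Set.range (divPow e) ∪ Set.range (divPow f) ∪
      {(K1 : Uq), ((K1⁻¹ : Uqˣ) : Uq), (K2 : Uq), ((K2⁻¹ : Uqˣ) : Uq)})

/-! #### Commutation rules needed to define the bialgebra structure -/

theorem commute_K : Commute K1 K2 := Units.ext (by simpa [K1, K2, gen] using rel .K1_comm_K2)

theorem K1_e : (K1 : Uq) * e = v • (e * K1) := by
  have h : (K1 : Uq) * e * ((K1⁻¹ : Uqˣ) : Uq) = v • e := by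
    simpa [K1, e, gen, Units.inv_mk] using rel .K1_e
  rw [Units.mul_inv_eq_iff_eq_mul] at h
  rw [h, smul_mul_assoc]

theorem K1_f : (K1 : Uq) * f = v⁻¹ • (f * K1) := by
  have h : (K1 : Uq) * f * ((K1⁻¹ : Uqˣ) : Uq) = v⁻¹ • f := by
    simpa [K1, f, gen, Units.inv_mk] using rel .K1_f
  rw [Units.mul_inv_eq_iff_eq_mul] at h
  rw [h, smul_mul_assoc]

theorem K2_e : (K2 : Uq) * e = v⁻¹ • (e * K2) := by
  have h : (K2 : Uq) * e * ((K2⁻¹ : Uqˣ) : Uq) = v⁻¹ • e := by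
    simpa [K2, e, gen, Units.inv_mk] using rel .K2_e
  rw [Units.mul_inv_eq_iff_eq_mul] at h
  rw [h, smul_mul_assoc]

theorem K2_f : (K2 : Uq) * f = v • (f * K2) := by
  have h : (K2 : Uq) * f * ((K2⁻¹ : Uqˣ) : Uq) = v • f := by
    simpa [K2, f, gen, Units.inv_mk] using rel .K2_f
  rw [Units.mul_inv_eq_iff_eq_mul] at h
  rw [h, smul_mul_assoc]

/-- `K = K₁ K₂⁻¹`. -/
def K : Uqˣ := K1 * K2⁻¹

theorem e_f : e * f - f * e = (v - v⁻¹)⁻¹ • ((K : Uq) - ((K⁻¹ : Uqˣ) : Uq)) := by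
  have h := rel .e_f
  have hK : K⁻¹ = K1⁻¹ * K2 := by
    rw [K, mul_inv_rev, inv_inv]; exact (commute_K.symm.inv_right).eq
  rw [hK, K]
  simpa [K1, K2, e, f, gen, Units.inv_mk] using h

theorem inv_rule (k : Uqˣ) (x : Uq) (c : Qv) (hc : c ≠ 0) (h : (k : Uq) * x = c • (x * k)) :
    ((k⁻¹ : Uqˣ) : Uq) * x = c⁻¹ • (x * ((k⁻¹ : Uqˣ) : Uq)) := by
  rw [Units.inv_mul_eq_iff_eq_mul, mul_smul_comm, ← mul_assoc, h, smul_mul_assoc, smul_smul,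
    inv_mul_cancel₀ hc, one_smul, Units.mul_inv_cancel_right]

theorem K_f : (K : Uq) * f = (v⁻¹ * v⁻¹) • (f * K) := by
  rw [K, Units.val_mul, mul_assoc, inv_rule K2 f v v_ne_zero K2_f, mul_smul_comm, ← mul_assoc, K1_f,
    smul_mul_assoc, smul_smul, mul_assoc]

theorem K_e : (K : Uq) * e = (v * v) • (e * K) := by
  rw [K, Units.val_mul, mul_assoc, inv_rule K2 e v⁻¹ (inv_ne_zero v_ne_zero) K2_e, mul_smul_comm,
    ← mul_assoc, K1_e, smul_mul_assoc, smul_smul, mul_assoc, inv_inv]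

theorem Kinv_e : ((K⁻¹ : Uqˣ) : Uq) * e = (v * v)⁻¹ • (e * ((K⁻¹ : Uqˣ) : Uq)) :=
  inv_rule K e _ (mul_ne_zero v_ne_zero v_ne_zero) K_e

/-! #### Counit and comultiplication -/

/-- The counit `U → ℚ(v)`: `e, f ↦ 0`, `Kᵢ ↦ 1`. -/
def counit : Uq →ₐ[Qv] Qv :=
  RingQuot.liftAlgHom Qv ⟨FreeAlgebra.lift Qv fun x : UGen =>
    match x with
    | .e => 0
    | .f => 0
    | .K1 => 1
    | .K1' => 1
    | .K2 => 1
    | .K2' => 1, by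
    intro x y h
    cases h <;> simp⟩

/-- The values of the comultiplication on generators:
`Δ e = e ⊗ 1 + K ⊗ e`, `Δ f = f ⊗ K⁻¹ + 1 ⊗ f`, `Δ Kᵢ = Kᵢ ⊗ Kᵢ`, where `K = K₁ K₂⁻¹`. -/
def comulGen (x : UGen) : Uq ⊗[Qv] Uq :=
  match x with
  | .e => e ⊗ₜ 1 + (K : Uq) ⊗ₜ e
  | .f => f ⊗ₜ ((K⁻¹ : Uqˣ) : Uq) + 1 ⊗ₜ f
  | .K1 => (K1 : Uq) ⊗ₜ (K1 : Uq)
  | .K1' => ((K1⁻¹ : Uqˣ) : Uq) ⊗ₜ ((K1⁻¹ : Uqˣ) : Uq)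
  | .K2 => (K2 : Uq) ⊗ₜ (K2 : Uq)
  | .K2' => ((K2⁻¹ : Uqˣ) : Uq) ⊗ₜ ((K2⁻¹ : Uqˣ) : Uq)

theorem conj_rule (k : Uqˣ) (x : Uq) (c : Qv) (h : (k : Uq) * x = c • (x * k)) :
    (k : Uq) * x * ((k⁻¹ : Uqˣ) : Uq) = c • x := by
  rw [h, smul_mul_assoc, Units.mul_inv_cancel_right]

theorem conj_comm (k l : Uqˣ) (h : Commute k l) :
    (k : Uq) * l * ((k⁻¹ : Uqˣ) : Uq) = l := by
  rw [← Units.val_mul, h.eq, Units.val_mul, Units.mul_inv_cancel_right]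

theorem commute_K1_K : Commute K1 K := (Commute.refl K1).mul_right commute_K.inv_right

theorem commute_K2_K : Commute K2 K := commute_K.symm.mul_right (Commute.refl K2).inv_right

theorem conj_comul_e (k : Uqˣ) (c : Qv) (hK : Commute k K) (h : (k : Uq) * e = c • (e * k)) :
    ((k : Uq) ⊗ₜ[Qv] (k : Uq)) * comulGen .e *
      (((k⁻¹ : Uqˣ) : Uq) ⊗ₜ[Qv] ((k⁻¹ : Uqˣ) : Uq)) = c • comulGen .e := by
  simp only [comulGen, mul_add, add_mul, Algebra.TensorProduct.tmul_mul_tmul, mul_one,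
    conj_rule k e c h, conj_comm k K hK, Units.mul_inv, smul_add, TensorProduct.smul_tmul',
    TensorProduct.tmul_smul]

theorem conj_comul_f (k : Uqˣ) (c : Qv) (hK : Commute k K) (h : (k : Uq) * f = c • (f * k)) :
    ((k : Uq) ⊗ₜ[Qv] (k : Uq)) * comulGen .f *
      (((k⁻¹ : Uqˣ) : Uq) ⊗ₜ[Qv] ((k⁻¹ : Uqˣ) : Uq)) = c • comulGen .f := by
  simp only [comulGen, mul_add, add_mul, Algebra.TensorProduct.tmul_mul_tmul, mul_one,
    conj_rule k f c h, conj_comm k K⁻¹ hK.inv_right, Units.mul_inv, smul_add,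
    TensorProduct.smul_tmul', TensorProduct.tmul_smul]

theorem comul_e_f :
    comulGen .e * comulGen .f - comulGen .f * comulGen .e =
      (v - v⁻¹)⁻¹ • (comulGen .K1 * comulGen .K2' - comulGen .K1' * comulGen .K2) := by
  have hv := v_ne_zero
  have hK : ((K1⁻¹ : Uqˣ) : Uq) * (K2 : Uq) = ((K⁻¹ : Uqˣ) : Uq) := by
    rw [← Units.val_mul, K, mul_inv_rev, inv_inv, (commute_K.symm.inv_right).eq]
  have hK' : (K1 : Uq) * ((K2⁻¹ : Uqˣ) : Uq) = (K : Uq) := rfl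
  have cross : ((K : Uq) * f) ⊗ₜ[Qv] (e * ((K⁻¹ : Uqˣ) : Uq)) =
      (f * K) ⊗ₜ[Qv] (((K⁻¹ : Uqˣ) : Uq) * e) := by
    rw [K_f, Kinv_e, TensorProduct.smul_tmul, mul_inv]
  have h1 : e * f = f * e + (v - v⁻¹)⁻¹ • ((K : Uq) - ((K⁻¹ : Uqˣ) : Uq)) := by
    rw [← e_f]; abel
  simp only [comulGen, mul_add, add_mul, Algebra.TensorProduct.tmul_mul_tmul, mul_one, one_mul,
    cross, hK, hK']
  simp only [h1, TensorProduct.add_tmul, TensorProduct.tmul_add, TensorProduct.smul_tmul',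
    TensorProduct.tmul_smul, TensorProduct.sub_tmul, TensorProduct.tmul_sub, smul_sub]
  abel

/-- The comultiplication `Δ : U → U ⊗ U`. -/
def comul : Uq →ₐ[Qv] Uq ⊗[Qv] Uq :=
  RingQuot.liftAlgHom Qv ⟨FreeAlgebra.lift Qv comulGen, by
    intro x y h
    cases h <;>
      simp only [map_mul, map_smul, map_sub, map_one, FreeAlgebra.lift_ι_apply]
    · simp only [comulGen, Algebra.TensorProduct.tmul_mul_tmul, ← Units.val_mul, commute_K.eq]
    · simp [comulGen, Algebra.TensorProduct.one_def]
    · simp [comulGen, Algebra.TensorProduct.one_def]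
    · simp [comulGen, Algebra.TensorProduct.one_def]
    · simp [comulGen, Algebra.TensorProduct.one_def]
    · exact conj_comul_e K1 v commute_K1_K K1_e
    · exact conj_comul_f K1 v⁻¹ commute_K1_K K1_f
    · exact conj_comul_e K2 v⁻¹ commute_K2_K K2_e
    · exact conj_comul_f K2 v commute_K2_K K2_f
    · exact comul_e_f⟩

end Uq

/-! ### The tensor powers of the natural module and the Schur algebras -/

/-- The natural two-dimensional module `E`, with its standard basis. -/
abbrev E : Type := Fin 2 → Qv

open Matrix in
/-- The representation of `U` on `E`, by matrices in the standard basis. -/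
def rho : Uq →ₐ[Qv] Module.End Qv E :=
  RingQuot.liftAlgHom Qv ⟨FreeAlgebra.lift Qv fun x : UGen =>
    toLinAlgEquiv' (match x with
      | .e => !![0, 1; 0, 0]
      | .f => !![0, 0; 1, 0]
      | .K1 => !![v, 0; 0, 1]
      | .K1' => !![v⁻¹, 0; 0, 1]
      | .K2 => !![1, 0; 0, v]
      | .K2' => !![1, 0; 0, v⁻¹]), by
    intro x y h
    have hv := v_ne_zero
    cases h <;>
      simp only [map_mul, map_smul, map_sub, map_one, FreeAlgebra.lift_ι_apply] <;>
      simp only [← map_mul, ← map_smul, ← map_sub, ← map_one (toLinAlgEquiv' (R := Qv) (n := Fin 2))]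
        <;> congr 1 <;> ext i j <;> fin_cases i <;> fin_cases j <;> simp [hv]
    · exact (inv_mul_cancel₀ v_sub_inv_ne_zero).symm
    · rw [← neg_sub v v⁻¹, mul_neg, inv_mul_cancel₀ v_sub_inv_ne_zero]⟩

/-- The `d`-th tensor power `E^{⊗ d}`. -/
def TE (d : ℕ) : Type := TensorPower Qv d E

instance (d : ℕ) : AddCommGroup (TE d) := inferInstanceAs (AddCommGroup (TensorPower Qv d E))

instance (d : ℕ) : Module Qv (TE d) := inferInstanceAs (Module Qv (TensorPower Qv d E))

instance (d : ℕ) : Module LaurentZ (TE d) := Module.compHom (TE d) (algebraMap LaurentZ Qv)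

instance (d : ℕ) : IsScalarTower LaurentZ Qv (TE d) :=
  IsScalarTower.of_algebraMap_smul fun _ _ => rfl

/-- The identification of the carrier of `TE d` with Mathlib's tensor power. -/
def TE.equiv (d : ℕ) : TE d ≃ₗ[Qv] TensorPower Qv d E := LinearEquiv.refl Qv (TensorPower Qv d E)

/-- The identification of `E^{⊗ d} ⊗ E` with `E^{⊗ (d + 1)}`. -/
def snocEquiv (d : ℕ) : TE d ⊗[Qv] E ≃ₗ[Qv] TE (d + 1) :=
  (TensorProduct.congr (TE.equiv d)
    (PiTensorProduct.subsingletonEquiv (R := Qv) (s := fun _ : Fin 1 => E) (0 : Fin 1)).symm) ≪≫ₗ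
    TensorPower.mulEquiv ≪≫ₗ (TE.equiv (d + 1)).symm

/-- The representation of `U` on `E^{⊗ d}` given by iterating the comultiplication; on
`E^{⊗ 0} = ℚ(v)` it is the counit. -/
def rhoPow : (d : ℕ) → Uq →ₐ[Qv] Module.End Qv (TE d)
  | 0 => (Algebra.ofId Qv (Module.End Qv (TE 0))).comp Uq.counit
  | d + 1 =>
    ((snocEquiv d).conjAlgEquiv Qv).toAlgHom.comp
      ((Module.endTensorEndAlgHom (R := Qv) (A := Qv) (M := TE d) (N := E)).comp
        ((Algebra.TensorProduct.map (rhoPow d) rho).comp Uq.comul))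

/-- The quantum Schur algebra `S_v(2,d)`: the image of `U` in `End(E^{⊗ d})`. -/
def Sv (d : ℕ) : Subalgebra Qv (Module.End Qv (TE d)) := (rhoPow d).range

namespace Sv

variable (d : ℕ)

/-- The surjection `U → S_v(2,d)`. -/
def proj : Uq →ₐ[Qv] Sv d := (rhoPow d).rangeRestrict

/-- The image of `e` in `S_v(2,d)`. -/
def e : Sv d := proj d Uq.e
/-- The image of `f` in `S_v(2,d)`. -/
def f : Sv d := proj d Uq.f
/-- The image of `K₁` in `S_v(2,d)`. -/
def K1 : (Sv d)ˣ := Units.map (proj d : Uq →* Sv d) Uq.K1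
/-- The image of `K₂` in `S_v(2,d)`. -/
def K2 : (Sv d)ˣ := Units.map (proj d : Uq →* Sv d) Uq.K2

/-- The integral Schur algebra `S_A(2,d)`: the image of `U_A` in `S_v(2,d)`. -/
def SA : Subalgebra LaurentZ (Sv d) := Uq.UA.map ((proj d).restrictScalars LaurentZ)

end Sv

/-! ### The two presented algebras -/

/-- Generators of a presented algebra; `K'` stands for the inverse of `K`. -/
inductive PGen : Type
  | e | f | K | K'

open PGen in
/-- Relations of the presentation by `e`, `f`, `K₁`, `K₁⁻¹`. -/
inductive P1Rel (d : ℕ) : FreeAlgebra Qv PGen → FreeAlgebra Qv PGen → Prop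
  | mul_inv : P1Rel d (.ι Qv K * .ι Qv K') 1
  | inv_mul : P1Rel d (.ι Qv K' * .ι Qv K) 1
  | K_e : P1Rel d (.ι Qv K * .ι Qv e * .ι Qv K') (v • .ι Qv e)
  | K_f : P1Rel d (.ι Qv K * .ι Qv f * .ι Qv K') (v⁻¹ • .ι Qv f)
  | e_f : P1Rel d (.ι Qv e * .ι Qv f - .ι Qv f * .ι Qv e)
      ((v - v⁻¹)⁻¹ • ((v ^ d)⁻¹ • .ι Qv K ^ 2 - v ^ d • .ι Qv K' ^ 2))
  | minpoly : P1Rel d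
      ((List.range (d + 1)).map fun i => .ι Qv K - algebraMap Qv _ (v ^ i)).prod 0

open PGen in
/-- Relations of the presentation by `e`, `f`, `K₂`, `K₂⁻¹`. -/
inductive P2Rel (d : ℕ) : FreeAlgebra Qv PGen → FreeAlgebra Qv PGen → Prop
  | mul_inv : P2Rel d (.ι Qv K * .ι Qv K') 1
  | inv_mul : P2Rel d (.ι Qv K' * .ι Qv K) 1
  | K_e : P2Rel d (.ι Qv K * .ι Qv e * .ι Qv K') (v⁻¹ • .ι Qv e)
  | K_f : P2Rel d (.ι Qv K * .ι Qv f * .ι Qv K') (v • .ι Qv f)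
  | e_f : P2Rel d (.ι Qv e * .ι Qv f - .ι Qv f * .ι Qv e)
      ((v - v⁻¹)⁻¹ • (v ^ d • .ι Qv K' ^ 2 - (v ^ d)⁻¹ • .ι Qv K ^ 2))
  | minpoly : P2Rel d
      ((List.range (d + 1)).map fun i => .ι Qv K - algebraMap Qv _ (v ^ i)).prod 0

/-- The algebra presented by `e`, `f`, `K₁`, `K₁⁻¹`. -/
abbrev P1 (d : ℕ) : Type := RingQuot (P1Rel d)

/-- The algebra presented by `e`, `f`, `K₂`, `K₂⁻¹`. -/
abbrev P2 (d : ℕ) : Type := RingQuot (P2Rel d)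

namespace P1

variable (d : ℕ)

/-- The image of a generator. -/
def gen (x : PGen) : P1 d := RingQuot.mkAlgHom Qv (P1Rel d) (FreeAlgebra.ι Qv x)

/-- The generator `e`. -/
def e : P1 d := gen d .e
/-- The generator `f`. -/
def f : P1 d := gen d .f

/-- The generator `K₁`. -/
def K1 : (P1 d)ˣ where
  val := gen d .K
  inv := gen d .K'
  val_inv := by simpa [gen] using RingQuot.mkAlgHom_rel Qv (P1Rel.mul_inv (d := d))
  inv_val := by simpa [gen] using RingQuot.mkAlgHom_rel Qv (P1Rel.inv_mul (d := d))

/-- `K₂ = v ^ d K₁⁻¹`. -/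
def K2 : (P1 d)ˣ := Units.map (algebraMap Qv (P1 d) : Qv →* P1 d) (vUnit ^ d) * (K1 d)⁻¹

end P1

namespace P2

variable (d : ℕ)

/-- The image of a generator. -/
def gen (x : PGen) : P2 d := RingQuot.mkAlgHom Qv (P2Rel d) (FreeAlgebra.ι Qv x)

/-- The generator `e`. -/
def e : P2 d := gen d .e
/-- The generator `f`. -/
def f : P2 d := gen d .f

/-- The generator `K₂`. -/
def K2 : (P2 d)ˣ where
  val := gen d .K
  inv := gen d .K'
  val_inv := by simpa [gen] using RingQuot.mkAlgHom_rel Qv (P2Rel.mul_inv (d := d))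
  inv_val := by simpa [gen] using RingQuot.mkAlgHom_rel Qv (P2Rel.inv_mul (d := d))

/-- `K₁ = v ^ d K₂⁻¹`. -/
def K1 : (P2 d)ˣ := Units.map (algebraMap Qv (P2 d) : Qv →* P2 d) (vUnit ^ d) * (K2 d)⁻¹

end P2

/-! ### Index sets of the bases -/

/-- Quadruples `(a, b₁, b₂, c)` of natural numbers with `b₁ + b₂ = d` and `a + b₁ + c ≤ d`. -/
abbrev Idx1 (d : ℕ) : Type :=
  {p : ℕ × ℕ × ℕ × ℕ // p.2.1 + p.2.2.1 = d ∧ p.1 + p.2.1 + p.2.2.2 ≤ d}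

/-- Quadruples `(a, b₁, b₂, c)` of natural numbers with `b₁ + b₂ = d` and `a + b₂ + c ≤ d`. -/
abbrev Idx2 (d : ℕ) : Type :=
  {p : ℕ × ℕ × ℕ × ℕ // p.2.1 + p.2.2.1 = d ∧ p.1 + p.2.2.1 + p.2.2.2 ≤ d}

/-- `x^(a) [K₁; b₁] [K₂; b₂] y^(c)`, for a quadruple `p = (a, b₁, b₂, c)`. -/
def monomial {B : Type*} [Ring B] [Algebra Qv B] (x y : B) (K1 K2 : Bˣ) (p : ℕ × ℕ × ℕ × ℕ) : B :=
  divPow x p.1 * qBinom K1 p.2.1 * qBinom K2 p.2.2.1 * divPow y p.2.2.2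

end QSchur

end

noncomputable section

namespace QSchur

/-! All three algebras, `Sv d`, `P1 d` and `P2 d`, satisfy the short list of relations `SchurDatum`:
the relations of `U`, the identity `K₁ K₂ = v ^ d`, and a splitting of 1 into `K₁`-eigenvectors with
eigenvalues `v ^ j`, `0 ≤ j ≤ d`. From these alone, `1_m = [K₁; m] [K₂; d - m]` is the projection to
weight `m`, and the `1_m` sum to 1.

Spanning. Kostant's formula (`zp_e_zp_f_mul`) rewrites `e^(a) 1_m f^(c)` in terms of products `f 1
e` with coefficients in `ℤ[v, v⁻¹]`. Its mirror image rewrites `f^(c) 1_m e^(a)` in terms of `e^(a')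
1_{m'} f^(c')` with `a' + m' + c' = m - t`, which is at most `d` because `m ≤ d`. Applying both puts
every `e^(a) 1_m f^(c)` in the integral span of the monomials of the theorem. That span is therefore
stable under left multiplication by the generators, and it contains 1, so it contains the integral
form. Conversely, the integral form contains each `1_m` (`wt_mem`): Kostant's formula yields Cartan
elements acting on weights by Gaussian binomials, and a unitriangular system recovers the
projections. Only one of `K₁`, `K₂` is needed for this.

Independence. On `E^{⊗ d}`, a weight vector and a functional are built by induction on `d` that
detect a given `e^(a) f^(c)` and kill all products with a smaller exponent (`exists_separates`). In
a linear relation, a monomial with nonzero coefficient and maximal `a + c` is isolated in this way.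

Presentations. If an algebra generated by a Schur datum maps to `Sv d` compatibly, its spanning
monomials go to a linearly independent family, so the map is injective. The second basis follows
from the symmetry `e ↔ f`, `K₁ ↔ K₂` and a dimension count. -/

/-! ### Quantum integers and Gaussian binomials, with their integrality. -/

theorem v_zpow (k : ℤ) : v ^ k = algebraMap LaurentZ Qv (LaurentPolynomial.T k) := by
  have h : ∀ n : ℕ, v ^ n = algebraMap LaurentZ Qv (LaurentPolynomial.T n) := by
    intro n
    rw [v, ← map_pow, LaurentPolynomial.T_pow, mul_one]
  obtain ⟨n, rfl | rfl⟩ := k.eq_nat_or_neg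
  · simpa using h n
  · rw [zpow_neg, zpow_natCast, h, inv_eq_iff_eq_inv]
    refine eq_inv_of_mul_eq_one_left ?_
    rw [← map_mul, ← LaurentPolynomial.T_add]
    simp

theorem v_zpow_injective : Function.Injective fun k : ℤ => v ^ k := by
  intro k l h
  simp only [v_zpow] at h
  have h3 := IsFractionRing.injective LaurentZ Qv h
  have h4 := congrArg LaurentPolynomial.degree h3
  rw [LaurentPolynomial.degree_T, LaurentPolynomial.degree_T] at h4
  exact WithBot.coe_injective h4

theorem qInt_ne_zero {r : ℤ} (hr : r ≠ 0) : qInt r ≠ 0 := by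
  refine div_ne_zero (sub_ne_zero.2 fun h => hr ?_) v_sub_inv_ne_zero
  have := v_zpow_injective h
  omega

@[simp] theorem qInt_zero : qInt 0 = 0 := by simp [qInt]

@[simp] theorem qInt_one : qInt 1 = 1 := by
  simp [qInt, div_self v_sub_inv_ne_zero]

theorem qFact_succ (m : ℕ) : qFact (m + 1) = qFact m * qInt (m + 1) := by
  rw [qFact, Finset.prod_range_succ]; rfl

/-- The identity `[A][M] = [A - t][M - t] + [A + M - t][t]`. -/
theorem qInt_mul_qInt (A M t : ℤ) :
    qInt A * qInt M = qInt (A - t) * qInt (M - t) + qInt (A + M - t) * qInt t := by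
  have hv := v_ne_zero
  have h := v_sub_inv_ne_zero
  simp only [qInt, div_mul_div_comm, ← add_div, neg_sub]
  congr 1
  simp only [sub_eq_add_neg, zpow_add₀ hv, zpow_neg]
  have h1 := zpow_ne_zero A hv
  have h2 := zpow_ne_zero M hv
  have h3 := zpow_ne_zero t hv
  field_simp
  ring

theorem qInt_add (r s : ℤ) : qInt (r + s) = v ^ s * qInt r + v ^ (-r) * qInt s := by
  have hv := v_ne_zero
  simp only [qInt, mul_div_assoc', ← add_div, neg_add, zpow_add₀ hv, zpow_neg]
  congr 1
  ring

/-- The quantum binomial coefficient with arbitrary integral upper entry. -/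
def qb (N : ℤ) (t : ℕ) : Qv := ∏ s ∈ Finset.range t, qInt (N - s) / qInt (s + 1)

@[simp] theorem qb_zero_right (N : ℤ) : qb N 0 = 1 := rfl

theorem qb_succ (N : ℤ) (t : ℕ) : qb N (t + 1) = qb N t * (qInt (N - t) / qInt (t + 1)) := by
  rw [qb, Finset.prod_range_succ]; rfl

theorem qb_eq_zero {j t : ℕ} (h : j < t) : qb j t = 0 :=
  Finset.prod_eq_zero (Finset.mem_range.2 h) (by simp)

/-- Absorption: the numerators of the two sides differ only by the factor `[N + 1]`, the
denominators by `[t + 1]`. -/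
theorem qb_succ_succ (N : ℤ) (t : ℕ) :
    qb (N + 1) (t + 1) = qb N t * (qInt (N + 1) / qInt (t + 1)) := by
  induction t with
  | zero => simp [qb]
  | succ t ih =>
    rw [qb_succ, ih, qb_succ]
    have h1 : qInt ((t : ℤ) + 1) ≠ 0 := qInt_ne_zero (by omega)
    have h2 : qInt (((t + 1 : ℕ) : ℤ) + 1) ≠ 0 := qInt_ne_zero (by omega)
    rw [show N + 1 - ((t + 1 : ℕ) : ℤ) = N - t by push_cast; ring]
    field_simp

theorem qb_self (j : ℕ) : qb j j = 1 := by
  induction j with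
  | zero => rfl
  | succ j ih =>
    rw [Nat.cast_succ, qb_succ_succ, ih, one_mul, div_self (qInt_ne_zero (by omega))]

theorem qb_pascal (N : ℤ) (t : ℕ) :
    qb (N + 1) (t + 1) = v ^ ((t : ℤ) + 1) * qb N (t + 1) + v ^ ((t : ℤ) - N) * qb N t := by
  have h1 : qInt ((t : ℤ) + 1) ≠ 0 := qInt_ne_zero (by omega)
  rw [qb_succ_succ, qb_succ, show N + 1 = (N - t) + (t + 1) by ring, qInt_add, neg_sub]
  field_simp

/-- This is `qInt_mul_qInt` at `(A + 1, N + 1, t + 1)`, scaled by `qb N t / [t + 1]`. It is the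
coefficient identity behind the induction step of Kostant's formula. -/
theorem qb_commutation (A N : ℤ) (t : ℕ) :
    qInt (A + 1) * qb (N + 1) (t + 1) =
      qInt (A - t) * qb N (t + 1) + qInt (N + A - t + 1) * qb N t := by
  have h1 : qInt ((t : ℤ) + 1) ≠ 0 := qInt_ne_zero (by omega)
  have h := qInt_mul_qInt (A + 1) (N + 1) (t + 1)
  rw [show A + 1 - ((t : ℤ) + 1) = A - t by ring, show N + 1 - ((t : ℤ) + 1) = N - t by ring,
    show A + 1 + (N + 1) - ((t : ℤ) + 1) = N + A - t + 1 by ring] at h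
  rw [qb_succ_succ, qb_succ]
  field_simp
  linear_combination qb N t * h

/-- The copy of `ℤ[v, v⁻¹]` in `ℚ(v)`. -/
def integral : Subring Qv := (algebraMap LaurentZ Qv).range

theorem v_zpow_mem (k : ℤ) : v ^ k ∈ integral := ⟨_, (v_zpow k).symm⟩

/-- In the Pascal rule the coefficient of `qb N (t + 1)` is a power of `v`, hence a unit of `ℤ[v,
v⁻¹]`. The rule can therefore be run both upwards and downwards in `N`, starting from `N = 0`. -/
theorem qb_mem (N : ℤ) (t : ℕ) : qb N t ∈ integral := by
  induction t generalizing N with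
  | zero => exact one_mem _
  | succ t ih =>
    induction N with
    | zero =>
      have : qb 0 (t + 1) = 0 := by exact_mod_cast qb_eq_zero (Nat.succ_pos t)
      rw [this]; exact zero_mem _
    | succ N hN =>
      rw [qb_pascal]
      exact add_mem (mul_mem (v_zpow_mem _) hN) (mul_mem (v_zpow_mem _) (ih _))
    | pred N hN =>
      have h := qb_pascal (-N - 1) t
      rw [sub_add_cancel] at h
      have h2 : qb (-N - 1) (t + 1) = v ^ (-((t : ℤ) + 1)) *
          (qb (-N) (t + 1) - v ^ ((t : ℤ) - (-N - 1)) * qb (-N - 1) t) := by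
        rw [h, add_sub_cancel_right, ← mul_assoc, ← zpow_add₀ v_ne_zero]
        simp
      rw [h2]
      exact mul_mem (v_zpow_mem _) (sub_mem hN (mul_mem (v_zpow_mem _) (ih _)))

/-! ### Divided powers and quantum binomials acting on weight vectors. -/

section DividedPowers

variable {B : Type*} [Ring B] [Algebra Qv B]

/-- Divided powers with integral exponent; they vanish for negative exponents. -/
def zp (x : B) (m : ℤ) : B := if m < 0 then 0 else divPow x m.toNat

theorem zp_natCast (x : B) (m : ℕ) : zp x m = divPow x m := by
  simp [zp]

theorem zp_of_neg (x : B) {m : ℤ} (h : m < 0) : zp x m = 0 := if_pos h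

@[simp] theorem zp_zero (x : B) : zp x 0 = 1 := by
  simp [zp, divPow, qFact]

theorem mul_divPow (x : B) (m : ℕ) : x * divPow x m = qInt (m + 1) • divPow x (m + 1) := by
  have h : qInt ((m : ℤ) + 1) ≠ 0 := qInt_ne_zero (by omega)
  rw [divPow, divPow, qFact_succ, smul_smul, mul_inv, mul_comm, mul_assoc, inv_mul_cancel₀ h,
    mul_one, mul_smul_comm, pow_succ']

/-- No sign condition is needed: at `m = -1` the coefficient `[0]` vanishes. This lets later
formulas use integral indices without boundary cases. -/
theorem mul_zp (x : B) (m : ℤ) : x * zp x m = qInt (m + 1) • zp x (m + 1) := by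
  rcases lt_trichotomy m (-1) with h | rfl | h
  · rw [zp_of_neg x (by omega), zp_of_neg x (by omega), mul_zero, smul_zero]
  · simp [zp_of_neg x (show (-1 : ℤ) < 0 by norm_num)]
  · obtain ⟨n, rfl⟩ := Int.eq_ofNat_of_zero_le (show 0 ≤ m by omega)
    rw [zp_natCast, mul_divPow, ← zp_natCast]
    simp

theorem zp_add_one (x : B) {m : ℤ} (h : m + 1 ≠ 0) :
    zp x (m + 1) = (qInt (m + 1))⁻¹ • (x * zp x m) := by
  rw [mul_zp, smul_smul, inv_mul_cancel₀ (qInt_ne_zero h), one_smul]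

theorem zp_mul_zp (x : B) (a : ℕ) (m : ℤ) : zp x a * zp x m = qb (a + m) a • zp x (a + m) := by
  induction a with
  | zero => simp
  | succ a ih =>
    rw [Nat.cast_succ, zp_add_one x (by omega), smul_mul_assoc, mul_assoc, ih, mul_smul_comm,
      mul_zp, smul_smul, smul_smul, add_right_comm (a : ℤ) 1 m, qb_succ_succ,
      div_eq_mul_inv]
    congr 1
    ring

/-- An operator shifting weights by `s` shifts them by `m * s` when raised to a divided power. -/
theorem mul_zp_of_weight {k x : B} {s : ℤ} (h : k * x = v ^ s • (x * k)) (m : ℤ) :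
    k * zp x m = v ^ (s * m) • (zp x m * k) := by
  rw [zp]
  split_ifs with hm
  · simp
  · have hp : ∀ n : ℕ, k * x ^ n = v ^ (s * n) • (x ^ n * k) := by
      intro n
      induction n with
      | zero => simp
      | succ n ih =>
        rw [pow_succ, ← mul_assoc, ih, smul_mul_assoc, mul_assoc, h, mul_smul_comm, smul_smul,
          ← mul_assoc, Nat.cast_succ, mul_add, mul_one, zpow_add₀ v_ne_zero]
    obtain ⟨n, rfl⟩ := Int.eq_ofNat_of_zero_le (not_lt.1 hm)
    simp only [divPow, Int.toNat_natCast]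
    rw [mul_smul_comm, hp, smul_mul_assoc, smul_comm]

theorem inv_mul_of_weight {k : Bˣ} {y : B} {j : ℤ} (h : (k : B) * y = v ^ j • y) :
    ((k⁻¹ : Bˣ) : B) * y = v ^ (-j) • y := by
  rw [Units.inv_mul_eq_iff_eq_mul, mul_smul_comm, h, smul_smul, ← zpow_add₀ v_ne_zero]
  simp

theorem commute_qBinom {x : B} {k : Bˣ} (h : Commute x k) (t : ℕ) : Commute x (qBinom k t) := by
  refine Commute.list_prod_right _ _ fun y hy => ?_
  obtain ⟨i, -, rfl⟩ := List.mem_map.1 hy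
  exact ((h.smul_right _).sub_right (h.units_inv_right.smul_right _)).smul_right _

/-- Each factor of the product acts on an eigenvector of eigenvalue `v ^ j` by the scalar `[j - i] /
[i + 1]`, where `i` is the list index. -/
theorem qBinom_mul_of_weight {k : Bˣ} {y : B} {j : ℤ} (h : (k : B) * y = v ^ j • y) (t : ℕ) :
    qBinom k t * y = qb j t • y := by
  induction t with
  | zero => simp [qBinom]
  | succ t ih =>
    have hq : ∀ s : ℤ, v ^ s - v ^ (-s) = qInt s * (v - v⁻¹) := fun s =>
      (div_mul_cancel₀ _ v_sub_inv_ne_zero).symm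
    rw [qBinom, List.range_succ, List.map_append, List.prod_append, List.map_singleton,
      List.prod_singleton, mul_assoc, smul_mul_assoc, sub_mul, smul_mul_assoc, smul_mul_assoc, h,
      inv_mul_of_weight h, smul_smul, smul_smul, ← sub_smul, smul_smul, mul_smul_comm]
    rw [qBinom] at ih
    rw [ih, smul_smul, qb_succ, mul_comm]
    congr 2
    rw [← zpow_add₀ v_ne_zero, ← zpow_add₀ v_ne_zero, hq, mul_inv, div_eq_mul_inv,
      show -(t : ℤ) + j = j - t by ring, show (t : ℤ) + -j = -(j - t) by ring, hq]
    have := v_sub_inv_ne_zero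
    generalize v - v⁻¹ = w at this
    field_simp

end DividedPowers

/-- The relations in a Schur algebra of degree `d`: the defining relations of the quantized
enveloping algebra, `K₁ K₂ = v ^ d`, and the decomposition of the unit into weight vectors. -/
structure SchurDatum {B : Type*} [Ring B] [Algebra Qv B] (d : ℕ) (e f : B) (K1 K2 : Bˣ) :
    Prop where
  mul_eq : (K1 : B) * K2 = algebraMap Qv B (v ^ d)
  K1_e : (K1 : B) * e = v • (e * K1)
  K1_f : (K1 : B) * f = v⁻¹ • (f * K1)
  K2_e : (K2 : B) * e = v⁻¹ • (e * K2)
  K2_f : (K2 : B) * f = v • (f * K2)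
  e_f : e * f - f * e =
    (v - v⁻¹)⁻¹ • ((K1 : B) * ((K2⁻¹ : Bˣ) : B) - ((K1⁻¹ : Bˣ) : B) * K2)
  decomp : ∃ L : ℕ → B, ∑ j ∈ Finset.range (d + 1), L j = 1 ∧
    ∀ j ≤ d, (K1 : B) * L j = v ^ (j : ℤ) • L j

/-- The projection to the weight `m`, which is zero unless `0 ≤ m ≤ d`. -/
def wt {B : Type*} [Ring B] [Algebra Qv B] (d : ℕ) (K1 K2 : Bˣ) (m : ℤ) : B :=
  if 0 ≤ m ∧ m ≤ d then qBinom K1 m.toNat * qBinom K2 (d - m).toNat else 0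

/-! ### Weight projections in a Schur datum. -/

namespace SchurDatum

variable {B : Type*} [Ring B] [Algebra Qv B] {d : ℕ} {e f : B} {K1 K2 : Bˣ}

theorem mul_eq' (h : SchurDatum d e f K1 K2) : (K2 : B) * K1 = algebraMap Qv B (v ^ d) := by
  have h1 : (K2 : B) = ((K1⁻¹ : Bˣ) : B) * algebraMap Qv B (v ^ d) := by
    rw [← h.mul_eq, Units.inv_mul_cancel_left]
  rw [h1, mul_assoc, Algebra.commutes, Units.inv_mul_cancel_left]

theorem commute (h : SchurDatum d e f K1 K2) : Commute (K1 : B) K2 := h.mul_eq.trans h.mul_eq'.symm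

theorem K2_mul_of_weight (h : SchurDatum d e f K1 K2) {y : B} {j : ℤ}
    (hy : (K1 : B) * y = v ^ j • y) : (K2 : B) * y = v ^ (d - j) • y := by
  have h1 : v ^ j • ((K2 : B) * y) = v ^ (d : ℤ) • y := by
    rw [← mul_smul_comm, ← hy, ← mul_assoc, h.mul_eq', Algebra.smul_def, zpow_natCast]
  rw [sub_eq_neg_add, zpow_add₀ v_ne_zero, mul_smul, ← h1, smul_smul, ← zpow_add₀ v_ne_zero]
  simp

/-- The symmetry interchanging `e` with `f` and `K₁` with `K₂`. -/
theorem swap (h : SchurDatum d e f K1 K2) : SchurDatum d f e K2 K1 where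
  mul_eq := h.mul_eq'
  K1_e := h.K2_f
  K1_f := h.K2_e
  K2_e := h.K1_f
  K2_f := h.K1_e
  e_f := by
    have h1 : (K2 : B) * ((K1⁻¹ : Bˣ) : B) = ((K1⁻¹ : Bˣ) : B) * K2 :=
      h.commute.symm.units_inv_right
    have h2 : ((K2⁻¹ : Bˣ) : B) * (K1 : B) = K1 * ((K2⁻¹ : Bˣ) : B) :=
      h.commute.symm.units_inv_left
    rw [h1, h2, ← neg_sub, h.e_f, ← smul_neg, neg_sub]
  decomp := by
    obtain ⟨L, hL, hw⟩ := h.decomp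
    refine ⟨fun j => L (d - j), ?_, fun j hj => ?_⟩
    · rw [← hL, ← Finset.sum_range_reflect]
      exact Finset.sum_congr rfl fun j hj => by
        rw [Finset.mem_range] at hj
        congr 1
        omega
    · have := h.K2_mul_of_weight (hw (d - j) (Nat.sub_le _ _))
      rw [this, Nat.cast_sub hj, sub_sub_cancel]

/-- On weight `j` the element `1_b` acts by `qb j b * qb (d - j) (d - b)`. The first factor vanishes
for `b > j`, the second for `b < j`, and both are 1 for `b = j`. -/
theorem wt_mul_of_weight (h : SchurDatum d e f K1 K2) {y : B} {j : ℕ} (hj : j ≤ d)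
    (hy : (K1 : B) * y = v ^ (j : ℤ) • y) (m : ℤ) : wt d K1 K2 m * y = if m = j then y else 0 := by
  rw [wt]
  by_cases hm : 0 ≤ m ∧ m ≤ d
  · rw [if_pos hm]
    obtain ⟨b, rfl⟩ := Int.eq_ofNat_of_zero_le hm.1
    have h2 := h.K2_mul_of_weight hy
    have hb : b ≤ d := by omega
    rw [show ((d : ℤ) - b).toNat = d - b by omega, Int.toNat_natCast, mul_assoc,
      qBinom_mul_of_weight h2, mul_smul_comm, qBinom_mul_of_weight hy, smul_smul,
      ← Nat.cast_sub hj]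
    rcases lt_trichotomy b j with hlt | rfl | hlt
    · rw [qb_eq_zero (show d - j < d - b by omega), zero_mul, zero_smul, if_neg (by omega)]
    · rw [qb_self, qb_self, mul_one, one_smul, if_pos rfl]
    · rw [qb_eq_zero hlt, mul_zero, zero_smul, if_neg (by omega)]
  · rw [if_neg hm, zero_mul, if_neg (by omega)]

theorem wt_of_not (K1 K2 : Bˣ) {m : ℤ} (hm : ¬(0 ≤ m ∧ m ≤ d)) : wt d K1 K2 m = 0 := if_neg hm

theorem wt_natCast (K1 K2 : Bˣ) {b : ℕ} (hb : b ≤ d) :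
    wt d K1 K2 b = qBinom K1 b * qBinom K2 (d - b) := by
  rw [wt, if_pos (by omega), Int.toNat_natCast, show ((d : ℤ) - b).toNat = d - b by omega]

/-- The decomposition in the datum is not specified, but multiplying 1 = `∑ L j` by a weight
projection shows that it can only be the one given by `wt`. -/
theorem exists_eq_wt (h : SchurDatum d e f K1 K2) : ∃ L : ℕ → B,
    ∑ j ∈ Finset.range (d + 1), L j = 1 ∧ (∀ j ≤ d, (K1 : B) * L j = v ^ (j : ℤ) • L j) ∧
    ∀ j ≤ d, wt d K1 K2 j = L j := by
  obtain ⟨L, hL, hw⟩ := h.decomp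
  refine ⟨L, hL, hw, fun j hj => ?_⟩
  rw [← mul_one (wt d K1 K2 j), ← hL, Finset.mul_sum, Finset.sum_eq_single j]
  · rw [h.wt_mul_of_weight hj (hw j hj), if_pos rfl]
  · intro i hi hij
    have hi' : i ≤ d := by simpa [Nat.lt_succ_iff] using hi
    rw [h.wt_mul_of_weight hi' (hw i hi'), if_neg (by simpa using hij.symm)]
  · intro hj'; exact absurd (Finset.mem_range.2 (by omega)) hj'

theorem sum_wt (h : SchurDatum d e f K1 K2) :
    ∑ j ∈ Finset.range (d + 1), wt d K1 K2 (j : ℤ) = 1 := by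
  obtain ⟨L, hL, -, hw⟩ := h.exists_eq_wt
  rw [← hL]
  exact Finset.sum_congr rfl fun j hj => hw j (by simpa [Nat.lt_succ_iff] using hj)

theorem K1_mul_wt (h : SchurDatum d e f K1 K2) (m : ℤ) :
    (K1 : B) * wt d K1 K2 m = v ^ m • wt d K1 K2 m := by
  by_cases hm : 0 ≤ m ∧ m ≤ d
  · obtain ⟨b, rfl⟩ := Int.eq_ofNat_of_zero_le hm.1
    obtain ⟨L, -, hL, hw⟩ := h.exists_eq_wt
    rw [hw b (by omega), hL b (by omega)]
  · rw [wt_of_not K1 K2 hm, mul_zero, smul_zero]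

/-- The weight projections act on vectors of any integral weight as expected. -/
theorem wt_mul (h : SchurDatum d e f K1 K2) {y : B} {j : ℤ}
    (hy : (K1 : B) * y = v ^ j • y) (m : ℤ) : wt d K1 K2 m * y = if m = j then y else 0 := by
  by_cases hj : 0 ≤ j ∧ j ≤ d
  · obtain ⟨b, rfl⟩ := Int.eq_ofNat_of_zero_le hj.1
    exact h.wt_mul_of_weight (by omega) hy m
  -- A weight outside `[0, d]` does not occur: each `1_b` kills `y` since the eigenvalues `v ^ b`
  -- and `v ^ j` differ, and the `1_b` sum to 1, so `y = 0`.
  · have key : ∀ b : ℕ, b ≤ d → wt d K1 K2 b * y = 0 := by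
      intro b hb
      have h1 : (K1 : B) * wt d K1 K2 b = wt d K1 K2 b * K1 := by
        rw [wt_natCast K1 K2 hb]
        exact (commute_qBinom (Commute.refl _) _).mul_right (commute_qBinom h.commute _)
      have h2 : (v ^ (b : ℤ) - v ^ j) • (wt d K1 K2 b * y) = 0 := by
        rw [sub_smul, ← smul_mul_assoc, ← h.K1_mul_wt, h1, mul_assoc, hy, mul_smul_comm, sub_self]
      refine (smul_eq_zero.1 h2).resolve_left fun h3 => ?_
      have := v_zpow_injective (sub_eq_zero.1 h3)
      omega
    have hy0 : y = 0 := by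
      rw [← one_mul y, ← h.sum_wt, Finset.sum_mul]
      exact Finset.sum_eq_zero fun b hb => key b (by simpa [Nat.lt_succ_iff] using hb)
    simp [hy0]

theorem wt_swap (h : SchurDatum d e f K1 K2) (m : ℤ) : wt d K2 K1 m = wt d K1 K2 (d - m) := by
  have hc (s t : ℕ) : Commute (qBinom K1 s) (qBinom K2 t) := by
    have h1 := commute_qBinom h.commute t
    exact (commute_qBinom h1.symm s).symm
  by_cases hm : 0 ≤ m ∧ m ≤ d
  · rw [wt, wt, if_pos hm, if_pos (by omega), sub_sub_cancel, (hc _ _).eq]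
  · rw [wt, wt, if_neg hm, if_neg (by omega)]

/-! ### Commutation of divided powers with weights and with each other. -/

section Commutation

variable {B : Type*} [Ring B] [Algebra Qv B] {d : ℕ} {e f : B} {K1 K2 : Bˣ}

theorem K1_zp_e (h : SchurDatum d e f K1 K2) (a : ℤ) :
    (K1 : B) * zp e a = v ^ a • (zp e a * K1) := by
  simpa using mul_zp_of_weight (s := 1) (by simpa using h.K1_e) a

theorem K1_zp_f (h : SchurDatum d e f K1 K2) (c : ℤ) :
    (K1 : B) * zp f c = v ^ (-c) • (zp f c * K1) := by
  simpa using mul_zp_of_weight (s := -1) (by simpa using h.K1_f) c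

theorem weight_mul {k x y : B} {s m : ℤ} (hx : k * x = v ^ s • (x * k)) (hy : k * y = v ^ m • y) :
    k * (x * y) = v ^ (m + s) • (x * y) := by
  rw [← mul_assoc, hx, smul_mul_assoc, mul_assoc, hy, mul_smul_comm, smul_smul,
    ← zpow_add₀ v_ne_zero, add_comm]

/-- Insert 1 = `∑ 1_j` on the right of `1_{m+s} x`: since `x 1_j` has weight `j + s`, only `j = m`
survives. If `m` is out of range, both sides are zero. -/
theorem mul_wt (h : SchurDatum d e f K1 K2) {x : B} {s : ℤ}
    (hx : (K1 : B) * x = v ^ s • (x * K1)) (m : ℤ) :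
    x * wt d K1 K2 m = wt d K1 K2 (m + s) * x := by
  have h1 : wt d K1 K2 (m + s) * x =
      ∑ j ∈ Finset.range (d + 1), if m = j then x * wt d K1 K2 (j : ℤ) else 0 := by
    rw [← mul_one (_ * x), ← h.sum_wt, Finset.mul_sum]
    refine Finset.sum_congr rfl fun j _ => ?_
    rw [mul_assoc, h.wt_mul (weight_mul hx (h.K1_mul_wt j))]
    simp
  rw [h1]
  by_cases hm : 0 ≤ m ∧ m ≤ d
  · obtain ⟨b, rfl⟩ := Int.eq_ofNat_of_zero_le hm.1
    rw [Finset.sum_eq_single b]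
    · rw [if_pos rfl]
    · intro j _ hj
      exact if_neg fun h => hj (by exact_mod_cast h.symm)
    · intro hb
      exact absurd (Finset.mem_range.2 (by omega)) hb
  · rw [wt_of_not K1 K2 hm, mul_zero]
    refine (Finset.sum_eq_zero fun j hj => ?_).symm
    rw [Finset.mem_range] at hj
    exact if_neg (by omega)

theorem zp_e_mul_wt (h : SchurDatum d e f K1 K2) (a m : ℤ) :
    zp e a * wt d K1 K2 m = wt d K1 K2 (m + a) * zp e a := h.mul_wt (h.K1_zp_e a) m

theorem zp_f_mul_wt (h : SchurDatum d e f K1 K2) (c m : ℤ) :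
    zp f c * wt d K1 K2 m = wt d K1 K2 (m - c) * zp f c := h.mul_wt (h.K1_zp_f c) m

/-- On weight `m` the element `K₁ K₂⁻¹` acts by `v ^ (m - (d - m))`, so the commutator of `e` and
`f` acts by `[2m - d]`. -/
theorem e_f_mul (h : SchurDatum d e f K1 K2) {y : B} {m : ℤ} (hy : (K1 : B) * y = v ^ m • y) :
    e * (f * y) = f * (e * y) + qInt (2 * m - d) • y := by
  have h1 : e * f = f * e +
      (v - v⁻¹)⁻¹ • ((K1 : B) * ((K2⁻¹ : Bˣ) : B) - ((K1⁻¹ : Bˣ) : B) * K2) := by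
    rw [← h.e_f]; abel
  have h2 := h.K2_mul_of_weight hy
  rw [← mul_assoc, h1, add_mul, smul_mul_assoc, sub_mul, mul_assoc, mul_assoc, mul_assoc, h2,
    inv_mul_of_weight h2, mul_smul_comm, mul_smul_comm, hy, inv_mul_of_weight hy, smul_smul,
    smul_smul, ← zpow_add₀ v_ne_zero, ← zpow_add₀ v_ne_zero, ← sub_smul, smul_smul, qInt,
    div_eq_inv_mul]
  congr 5 <;> ring

/-- The case of a single `e` in Kostant's formula, by induction on the power of `f`. -/
theorem e_zp_f_mul (h : SchurDatum d e f K1 K2) {y : B} {m : ℤ} (hy : (K1 : B) * y = v ^ m • y)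
    (c : ℤ) : e * (zp f c * y) =
      zp f c * (e * y) + qInt (2 * m - d - c + 1) • (zp f (c - 1) * y) := by
  by_cases hc : c < 0
  · simp [zp_of_neg f hc, zp_of_neg f (show c - 1 < 0 by omega)]
  obtain ⟨n, rfl⟩ := Int.eq_ofNat_of_zero_le (not_lt.1 hc)
  clear hc
  induction n with
  | zero => simp [zp_of_neg f (show (-1 : ℤ) < 0 by norm_num)]
  | succ n ih =>
    have hn : (n : ℤ) + 1 ≠ 0 := by omega
    have hq := qInt_ne_zero hn
    have h3 := mul_zp f ((n : ℤ) - 1)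
    rw [sub_add_cancel] at h3
    -- With `A = 2m - d - n` this says `[A][n + 1] = [A - n] + [A + 1][n]`. The first summand comes
    -- from the commutator on weight `m - n`, the second from the induction hypothesis.
    have hA := qInt_mul_qInt (2 * m - d - n) (n + 1) n
    rw [show 2 * m - d - (n : ℤ) + (n + 1) - n = 2 * m - d - n + 1 by ring,
      show 2 * m - d - (n : ℤ) - n = 2 * (m + -n) - d by ring, add_sub_cancel_left, qInt_one,
      mul_one] at hA
    rw [Nat.cast_succ, add_sub_cancel_right, zp_add_one f hn, smul_mul_assoc, mul_smul_comm,
      mul_assoc, h.e_f_mul (weight_mul (h.K1_zp_f n) hy), ih, mul_add, mul_smul_comm,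
      ← mul_assoc f (zp f (n - 1)), h3, smul_mul_assoc, smul_mul_assoc, ← mul_assoc f, smul_smul,
      add_assoc, ← add_smul, smul_add, smul_smul]
    congr 2
    rw [show 2 * m - (d : ℤ) - (n + 1) + 1 = 2 * m - d - n by ring, inv_mul_eq_iff_eq_mul₀ hq]
    linear_combination -hA

/-- Kostant's commutation formula. -/
theorem zp_e_zp_f_mul (h : SchurDatum d e f K1 K2) {y : B} {m : ℤ}
    (hy : (K1 : B) * y = v ^ m • y) (a : ℕ) (c : ℤ) :
    zp e a * (zp f c * y) = ∑ t ∈ Finset.range (a + 1),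
      qb (a - c + 2 * m - d) t • (zp f (c - t) * (zp e (a - t) * y)) := by
  induction a with
  | zero => simp
  | succ a ih =>
    have ha : (a : ℤ) + 1 ≠ 0 := by omega
    have hq := qInt_ne_zero ha
    set N : ℤ := a - c + 2 * m - d with hN
    set F : ℕ → B := fun t => zp f (c - t) * (zp e (a + 1 - t) * y) with hF
    have hstep : ∀ t : ℕ, e * (zp f (c - t) * (zp e (a - t) * y)) =
        qInt (a + 1 - t) • F t + qInt (N + a - t + 1) • F (t + 1) := by
      intro t
      rw [h.e_zp_f_mul (weight_mul (h.K1_zp_e _) hy), ← mul_assoc e, mul_zp, smul_mul_assoc,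
        mul_smul_comm, show (a : ℤ) - t + 1 = a + 1 - t by ring,
        show 2 * (m + (a - t)) - d - (c - t) + 1 = N + a - t + 1 by rw [hN]; ring]
      simp only [hF]
      rw [show c - ((t + 1 : ℕ) : ℤ) = c - t - 1 by push_cast; ring,
        show (a : ℤ) + 1 - ((t + 1 : ℕ) : ℤ) = a - t by push_cast; ring]
    rw [Nat.cast_succ, zp_add_one e ha, smul_mul_assoc, mul_assoc, ih, Finset.mul_sum,
      inv_smul_eq_iff₀ hq]
    simp only [mul_smul_comm, hstep, smul_add, Finset.sum_add_distrib, smul_smul]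
    -- The added term `t = a + 1` has coefficient `[0]`. Splitting off `t = 0` then aligns this sum
    -- with the one in `F (t + 1)`.
    have h0 : ∑ t ∈ Finset.range (a + 1), (qb N t * qInt (a + 1 - t)) • F t =
        ∑ t ∈ Finset.range (a + 1 + 1), (qb N t * qInt (a + 1 - t)) • F t := by
      rw [Finset.sum_range_succ _ (a + 1)]
      simp
    rw [h0, Finset.sum_range_succ', add_right_comm, ← Finset.sum_add_distrib]
    conv_rhs => rw [Finset.sum_range_succ', smul_add, Finset.smul_sum]
    congr 1
    · refine Finset.sum_congr rfl fun t _ => ?_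
      rw [← add_smul, smul_smul, show (a : ℤ) + 1 - c + 2 * m - d = N + 1 by rw [hN]; ring,
        qb_commutation, mul_comm, mul_comm (qInt (a - t)), mul_comm (qInt (N + a - t + 1)),
        show (a : ℤ) + 1 - ((t + 1 : ℕ) : ℤ) = a - t by push_cast; ring, mul_comm]
      simp only [hF]
      rw [show (a : ℤ) + 1 - ((t + 1 : ℕ) : ℤ) = a - t by push_cast; ring]
    · simp [hF]

/-- The elements `e^(a) 1_m f^(c)` in terms of the elements `f^(c) 1_m e^(a)`. -/
theorem e_wt_f (h : SchurDatum d e f K1 K2) (a : ℕ) (m c : ℤ) :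
    zp e a * wt d K1 K2 m * zp f c = ∑ t ∈ Finset.range (a + 1),
      qb (a + c + 2 * m - d) t • (zp f (c - t) * wt d K1 K2 (m + a + c - t) * zp e (a - t)) := by
  have h1 : wt d K1 K2 m * zp f c = zp f c * wt d K1 K2 (m + c) := by
    rw [h.zp_f_mul_wt, add_sub_cancel_right]
  rw [mul_assoc, h1, h.zp_e_zp_f_mul (h.K1_mul_wt _)]
  refine Finset.sum_congr rfl fun t _ => ?_
  rw [h.zp_e_mul_wt, mul_assoc, show (a : ℤ) - c + 2 * (m + c) - d = a + c + 2 * m - d by ring,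
    show m + c + (a - t) = m + a + c - t by ring]

/-- The image of `e_wt_f` under the symmetry `swap`. The three indices of the `t`-th term on the
right add up to `m - t`. -/
theorem f_wt_e (h : SchurDatum d e f K1 K2) (c : ℕ) (m a : ℤ) :
    zp f c * wt d K1 K2 m * zp e a = ∑ t ∈ Finset.range (c + 1),
      qb (a + c + d - 2 * m) t • (zp e (a - t) * wt d K1 K2 (m - a - c + t) * zp f (c - t)) := by
  have h1 := h.swap.e_wt_f c (d - m) a
  simp only [h.wt_swap, sub_sub_cancel] at h1
  rw [h1]
  refine Finset.sum_congr rfl fun t _ => ?_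
  rw [show (c : ℤ) + a + 2 * (d - m) - d = a + c + d - 2 * m by ring,
    show (d : ℤ) - (d - m + c + a - t) = m - a - c + t by ring]

theorem monomial_eq (e f : B) (K1 K2 : Bˣ) {a b b' c : ℕ} (h : b + b' = d) :
    monomial e f K1 K2 (a, b, b', c) = zp e a * wt d K1 K2 b * zp f c := by
  rw [wt_natCast K1 K2 (by omega), zp_natCast, zp_natCast, monomial, ← mul_assoc,
    show d - b = b' by omega]

theorem K1_mul_monomial (h : SchurDatum d e f K1 K2) (a m c : ℤ) :
    (K1 : B) * (zp e a * wt d K1 K2 m * zp f c) =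
      v ^ (m + a) • (zp e a * wt d K1 K2 m * zp f c) := by
  rw [← mul_assoc, weight_mul (h.K1_zp_e a) (h.K1_mul_wt m), smul_mul_assoc]

end Commutation

/-! ### The integral form lies in the span of the monomials. -/

section IntegralForm

variable {B : Type*} [Ring B] [Algebra Qv B] [Algebra LaurentZ B]
  {d : ℕ} {e f : B} {K1 K2 : Bˣ}

variable (d e f K1 K2) in
/-- The `ℤ[v, v⁻¹]`-span of the monomials `e^(a) 1_b f^(c)` with `a + b + c ≤ d`. -/
def monomialSpan : Submodule LaurentZ B :=
  Submodule.span LaurentZ (Set.range fun p : Idx1 d => monomial e f K1 K2 p)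

theorem e_wt_f_mem_of_le (e f : B) (K1 K2 : Bˣ) (a m c : ℤ) (hd : a + m + c ≤ d) :
    zp e a * wt d K1 K2 m * zp f c ∈ monomialSpan d e f K1 K2 := by
  by_cases ha : a < 0
  · simp [zp_of_neg e ha]
  by_cases hc : c < 0
  · simp [zp_of_neg f hc]
  by_cases hm : 0 ≤ m ∧ m ≤ d
  · obtain ⟨a, rfl⟩ := Int.eq_ofNat_of_zero_le (not_lt.1 ha)
    obtain ⟨c, rfl⟩ := Int.eq_ofNat_of_zero_le (not_lt.1 hc)
    obtain ⟨b, rfl⟩ := Int.eq_ofNat_of_zero_le hm.1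
    have hb : b + (d - b) = d := by omega
    rw [← monomial_eq e f K1 K2 hb]
    exact Submodule.subset_span ⟨⟨(a, b, d - b, c), hb, by dsimp only; omega⟩, rfl⟩
  · simp [wt_of_not K1 K2 hm]

/-- A left multiplication preserves the span of the monomials as soon as it maps them into it. -/
theorem mul_mem_of_forall {x : B} (hx : ∀ (a : ℕ) (m c : ℤ),
      x * (zp e a * wt d K1 K2 m * zp f c) ∈ monomialSpan d e f K1 K2)
    {y : B} (hy : y ∈ monomialSpan d e f K1 K2) : x * y ∈ monomialSpan d e f K1 K2 := by
  induction hy using Submodule.span_induction with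
  | mem y hy =>
    obtain ⟨⟨⟨a, b, b', c⟩, hb, -⟩, rfl⟩ := hy
    dsimp only at hb ⊢
    rw [monomial_eq e f K1 K2 hb]
    exact hx a b c
  | zero => rw [mul_zero]; exact zero_mem _
  | add y z _ _ hy hz => rw [mul_add]; exact add_mem hy hz
  | smul r y _ hy => rw [mul_smul_comm]; exact Submodule.smul_mem _ r hy

variable [IsScalarTower LaurentZ Qv B]

theorem smul_mem_of_integral {q : Qv} (hq : q ∈ integral) (M : Submodule LaurentZ B) {x : B}
    (hx : x ∈ M) : q • x ∈ M := by
  obtain ⟨r, rfl⟩ := hq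
  rw [algebraMap_smul]
  exact M.smul_mem r hx

/-- The projection is zero unless `m ≤ d`, and in that case every term of `f_wt_e` has index sum `m
- t ≤ d`. -/
theorem f_wt_e_mem (h : SchurDatum d e f K1 K2) (c m a : ℤ) :
    zp f c * wt d K1 K2 m * zp e a ∈ monomialSpan d e f K1 K2 := by
  by_cases hc : c < 0
  · simp [zp_of_neg f hc]
  by_cases hm : 0 ≤ m ∧ m ≤ d
  · obtain ⟨c, rfl⟩ := Int.eq_ofNat_of_zero_le (not_lt.1 hc)
    rw [h.f_wt_e]
    exact Submodule.sum_mem _ fun t _ => smul_mem_of_integral (qb_mem _ _) _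
      (e_wt_f_mem_of_le e f K1 K2 _ _ _ (by omega))
  · simp [wt_of_not K1 K2 hm]

/-- The bound on `a + m + c` is removed by passing to the order `f 1 e`, where membership holds
without any bound. -/
theorem e_wt_f_mem (h : SchurDatum d e f K1 K2) (a m c : ℤ) :
    zp e a * wt d K1 K2 m * zp f c ∈ monomialSpan d e f K1 K2 := by
  by_cases ha : a < 0
  · simp [zp_of_neg e ha]
  obtain ⟨a, rfl⟩ := Int.eq_ofNat_of_zero_le (not_lt.1 ha)
  rw [h.e_wt_f]
  exact Submodule.sum_mem _ fun t _ => smul_mem_of_integral (qb_mem _ _) _ (h.f_wt_e_mem _ _ _)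

theorem one_mem_monomialSpan (h : SchurDatum d e f K1 K2) : 1 ∈ monomialSpan d e f K1 K2 := by
  rw [← h.sum_wt]
  refine Submodule.sum_mem _ fun j _ => ?_
  simpa using h.e_wt_f_mem 0 j 0

theorem divPow_e_mul_mem (h : SchurDatum d e f K1 K2) (n : ℕ) {y : B}
    (hy : y ∈ monomialSpan d e f K1 K2) : divPow e n * y ∈ monomialSpan d e f K1 K2 := by
  refine mul_mem_of_forall (fun a m c => ?_) hy
  rw [← zp_natCast, ← mul_assoc, ← mul_assoc, zp_mul_zp, smul_mul_assoc, smul_mul_assoc]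
  exact smul_mem_of_integral (qb_mem _ _) _ (h.e_wt_f_mem _ _ _)

/-- In the order `f 1 e` the new power of `f` merges with the old one at the cost of a Gaussian
binomial, which is integral. -/
theorem divPow_f_mul_mem (h : SchurDatum d e f K1 K2) (n : ℕ) {y : B}
    (hy : y ∈ monomialSpan d e f K1 K2) : divPow f n * y ∈ monomialSpan d e f K1 K2 := by
  refine mul_mem_of_forall (fun a m c => ?_) hy
  rw [h.e_wt_f, Finset.mul_sum]
  refine Submodule.sum_mem _ fun t _ => ?_
  rw [mul_smul_comm, ← zp_natCast, ← mul_assoc, ← mul_assoc, zp_mul_zp, smul_mul_assoc,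
    smul_mul_assoc]
  exact smul_mem_of_integral (qb_mem _ _) _
    (smul_mem_of_integral (qb_mem _ _) _ (h.f_wt_e_mem _ _ _))

theorem units_mul_mem (h : SchurDatum d e f K1 K2) {y : B}
    (hy : y ∈ monomialSpan d e f K1 K2) {x : B}
    (hx : x ∈ ({(K1 : B), ((K1⁻¹ : Bˣ) : B), (K2 : B), ((K2⁻¹ : Bˣ) : B)} : Set B)) :
    x * y ∈ monomialSpan d e f K1 K2 := by
  refine mul_mem_of_forall (fun a m c => ?_) hy
  have h1 := h.K1_mul_monomial a m c
  have h2 := h.K2_mul_of_weight h1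
  rcases hx with rfl | rfl | rfl | rfl
  · rw [h1]; exact smul_mem_of_integral (v_zpow_mem _) _ (h.e_wt_f_mem _ _ _)
  · rw [inv_mul_of_weight h1]; exact smul_mem_of_integral (v_zpow_mem _) _ (h.e_wt_f_mem _ _ _)
  · rw [h2]; exact smul_mem_of_integral (v_zpow_mem _) _ (h.e_wt_f_mem _ _ _)
  · rw [inv_mul_of_weight h2]; exact smul_mem_of_integral (v_zpow_mem _) _ (h.e_wt_f_mem _ _ _)

variable (e f K1 K2) in
/-- The integral form generated by both `K₁` and `K₂`. -/
def fullIntForm : Subalgebra LaurentZ B :=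
  Algebra.adjoin LaurentZ
    (Set.range (divPow e) ∪ Set.range (divPow f) ∪
      {(K1 : B), ((K1⁻¹ : Bˣ) : B), (K2 : B), ((K2⁻¹ : Bˣ) : B)})

theorem fullIntForm_le (h : SchurDatum d e f K1 K2) :
    Subalgebra.toSubmodule (fullIntForm e f K1 K2) ≤ monomialSpan d e f K1 K2 := by
  intro x hx
  -- The elements whose left multiplication preserves the span form a subalgebra, so it is enough to
  -- treat generators. Applying the result to `y = 1` gives membership.
  suffices ∀ y ∈ monomialSpan d e f K1 K2, x * y ∈ monomialSpan d e f K1 K2 by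
    simpa using this 1 h.one_mem_monomialSpan
  replace hx : x ∈ Algebra.adjoin LaurentZ _ := hx
  induction hx using Algebra.adjoin_induction with
  | mem x hx =>
    intro y hy
    rcases hx with (⟨n, rfl⟩ | ⟨n, rfl⟩) | hx
    · exact h.divPow_e_mul_mem n hy
    · exact h.divPow_f_mul_mem n hy
    · exact h.units_mul_mem hy hx
  | algebraMap r =>
    intro y hy
    rw [← Algebra.smul_def]
    exact Submodule.smul_mem _ r hy
  | add x z _ _ hx hz => intro y hy; rw [add_mul]; exact add_mem (hx y hy) (hz y hy)
  | mul x z _ _ hx hz => intro y hy; rw [mul_assoc]; exact hx _ (hz y hy)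

end IntegralForm

end SchurDatum

/-! ### The monomials lie in the integral form, with only one of `K₁`, `K₂`. -/

namespace SchurDatum

variable {B : Type*} [Ring B] [Algebra Qv B] {d : ℕ} {e f : B} {K1 K2 : Bˣ}

variable (d K1 K2) in
/-- The element acting on the weight space of weight `m` by the quantum binomial coefficient
`[2m - d + c; t]`. -/
def cartan (c : ℤ) (t : ℕ) : B :=
  ∑ m ∈ Finset.range (d + 1), qb (2 * m - d + c) t • wt d K1 K2 (m : ℤ)

/-- Pascal's rule on each weight space. The weight enters the second coefficient only through `v ^
(-2m)`, which is the action of `K₁⁻²`. -/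
theorem cartan_add_one (h : SchurDatum d e f K1 K2) (c : ℤ) (t : ℕ) :
    cartan d K1 K2 (c + 1) (t + 1) = v ^ ((t : ℤ) + 1) • cartan d K1 K2 c (t + 1) +
      v ^ (t + d - c) • (((K1⁻¹ : Bˣ) : B) * (((K1⁻¹ : Bˣ) : B) * cartan d K1 K2 c t)) := by
  simp only [cartan, Finset.mul_sum, Finset.smul_sum, ← Finset.sum_add_distrib]
  refine Finset.sum_congr rfl fun m _ => ?_
  rw [mul_smul_comm, mul_smul_comm, inv_mul_of_weight (h.K1_mul_wt m), mul_smul_comm,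
    inv_mul_of_weight (h.K1_mul_wt m), ← add_assoc, qb_pascal, add_smul, smul_smul, smul_smul,
    smul_smul, smul_smul]
  congr 2
  rw [show (t : ℤ) - (2 * m - d + c) = (t + d - c) + (-m + -m) by ring, zpow_add₀ v_ne_zero,
    zpow_add₀ v_ne_zero (-(m : ℤ))]
  ring

/-- Up to a unit of `ℤ[v, v⁻¹]`, inverting `K₁` gives `K₂`. This is why either one generates the
integral form together with the divided powers. -/
theorem K1_inv_eq (h : SchurDatum d e f K1 K2) :
    ((K1⁻¹ : Bˣ) : B) = v ^ (-(d : ℤ)) • (K2 : B) := by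
  refine (Units.inv_eq_of_mul_eq_one_left ?_)
  rw [smul_mul_assoc, h.mul_eq', Algebra.algebraMap_eq_smul_one, smul_smul, zpow_neg, zpow_natCast,
    inv_mul_cancel₀ (pow_ne_zero _ v_ne_zero), one_smul]

/-- The symmetry `(a, b₁, b₂, c) ↦ (a, b₂, b₁, c)` of the index sets of the two bases. -/
def idxSwap (d : ℕ) : Idx2 d ≃ Idx1 d where
  toFun p := ⟨(p.1.1, p.1.2.2.1, p.1.2.1, p.1.2.2.2), by have := p.2; dsimp only at *; omega⟩
  invFun p := ⟨(p.1.1, p.1.2.2.1, p.1.2.1, p.1.2.2.2), by have := p.2; dsimp only at *; omega⟩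
  left_inv _ := rfl
  right_inv _ := rfl

theorem monomial_idxSwap (h : SchurDatum d e f K1 K2) (p : Idx2 d) :
    monomial f e K2 K1 (idxSwap d p) = monomial f e K1 K2 p := by
  have hc : Commute (qBinom K2 p.1.2.2.1) (qBinom K1 p.1.2.1) :=
    (commute_qBinom (commute_qBinom h.commute _).symm _)
  simp only [monomial, idxSwap, Equiv.coe_fn_mk]
  rw [mul_assoc (divPow f _), hc.eq, ← mul_assoc (divPow f _)]

variable [Algebra LaurentZ B]

/-- Kostant's formula for `e^(t) f^(t)`, summed over all weights, has last term `cartan 0 t`. The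
other terms involve only `cartan 0 s` with `s < t`, so strong induction applies. -/
theorem cartan_zero_mem (h : SchurDatum d e f K1 K2) (S : Subalgebra LaurentZ B)
    (he : ∀ n, divPow e n ∈ S) (hf : ∀ n, divPow f n ∈ S) (t : ℕ) : cartan d K1 K2 0 t ∈ S := by
  induction t using Nat.strong_induction_on with
  | _ t ih =>
    have h1 : zp e t * zp f t = ∑ s ∈ Finset.range (t + 1),
        zp f (t - s : ℤ) * zp e (t - s : ℤ) * cartan d K1 K2 0 s := by
      rw [← mul_one (_ * _), ← h.sum_wt, Finset.mul_sum]
      simp only [cartan, Finset.mul_sum]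
      rw [Finset.sum_comm]
      refine Finset.sum_congr rfl fun m _ => ?_
      rw [mul_assoc, h.zp_e_zp_f_mul (h.K1_mul_wt _)]
      refine Finset.sum_congr rfl fun s _ => ?_
      rw [mul_smul_comm, mul_assoc, show (t : ℤ) - t + 2 * m - d = 2 * m - d + 0 by ring]
    rw [Finset.sum_range_succ, sub_self, zp_zero, zp_zero, one_mul, one_mul] at h1
    rw [eq_sub_of_add_eq' h1.symm, zp_natCast, zp_natCast]
    refine sub_mem (mul_mem (he t) (hf t)) (sum_mem fun s hs => ?_)
    rw [Finset.mem_range] at hs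
    rw [← Nat.cast_sub hs.le, zp_natCast, zp_natCast]
    exact mul_mem (mul_mem (hf _) (he _)) (ih s hs)

theorem fullIntForm_swap (e f : B) (K1 K2 : Bˣ) :
    fullIntForm f e K2 K1 = fullIntForm e f K1 K2 := by
  rw [fullIntForm, fullIntForm, Set.union_comm (Set.range (divPow f))]
  congr 2
  ext x
  simp only [Set.mem_insert_iff, Set.mem_singleton_iff]
  tauto

variable [IsScalarTower LaurentZ Qv B]

theorem smul_mem_subalgebra {q : Qv} (hq : q ∈ integral) (S : Subalgebra LaurentZ B) {x : B}
    (hx : x ∈ S) : q • x ∈ S :=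
  smul_mem_of_integral hq (Subalgebra.toSubmodule S) hx

theorem cartan_mem (h : SchurDatum d e f K1 K2) (S : Subalgebra LaurentZ B)
    (he : ∀ n, divPow e n ∈ S) (hf : ∀ n, divPow f n ∈ S) (hK : ((K1⁻¹ : Bˣ) : B) ∈ S)
    (c t : ℕ) : cartan d K1 K2 c t ∈ S := by
  induction c generalizing t with
  | zero => exact h.cartan_zero_mem S he hf t
  | succ c ih =>
    cases t with
    | zero =>
      have : cartan d K1 K2 ((c + 1 : ℕ) : ℤ) 0 = 1 := by simp [cartan, h.sum_wt]
      rw [this]; exact one_mem _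
    | succ t =>
      rw [Nat.cast_succ, h.cartan_add_one]
      exact add_mem (smul_mem_subalgebra (v_zpow_mem _) S (ih _))
        (smul_mem_subalgebra (v_zpow_mem _) S (mul_mem hK (mul_mem hK (ih t))))

/-- The weight projections belong to the integral form. -/
theorem wt_mem (h : SchurDatum d e f K1 K2) (S : Subalgebra LaurentZ B)
    (he : ∀ n, divPow e n ∈ S) (hf : ∀ n, divPow f n ∈ S) (hK : ((K1⁻¹ : Bˣ) : B) ∈ S)
    {b : ℕ} (hb : b ≤ d) : wt d K1 K2 b ∈ S := by
  suffices ∀ n b : ℕ, b + n = d → wt d K1 K2 b ∈ S from this (d - b) b (by omega)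
  intro n
  induction n using Nat.strong_induction_on with
  | _ n ih =>
    intro b hb
    -- The shift `d` turns the upper entry `2m - d` into `2m ≥ 0`. With lower entry `2b` the
    -- coefficient is 0 for `m < b` and 1 for `m = b`, so `1_b` is found by downward induction on
    -- `b`.
    have h1 : cartan d K1 K2 d (2 * b) =
        ∑ m ∈ Finset.range (d + 1), qb ((2 * m : ℕ) : ℤ) (2 * b) • wt d K1 K2 (m : ℤ) := by
      refine Finset.sum_congr rfl fun m _ => ?_
      rw [sub_add_cancel, Nat.cast_mul, Nat.cast_two]
    rw [← Finset.add_sum_erase _ _ (Finset.mem_range.2 (show b < d + 1 by omega)), qb_self,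
      one_smul] at h1
    rw [eq_sub_of_add_eq h1.symm]
    refine sub_mem (h.cartan_mem S he hf hK d _) (sum_mem fun m hm => ?_)
    rw [Finset.mem_erase, Finset.mem_range] at hm
    rcases lt_or_gt_of_ne hm.1 with hlt | hlt
    · rw [qb_eq_zero (by omega), zero_smul]; exact zero_mem _
    · exact smul_mem_subalgebra (qb_mem _ _) S (ih (d - m) (by omega) m (by omega))

/-- Stated for an arbitrary subalgebra so that it serves for the full integral form and for both
forms with a single `K`. -/
theorem monomialSpan_le (h : SchurDatum d e f K1 K2) (S : Subalgebra LaurentZ B)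
    (he : ∀ n, divPow e n ∈ S) (hf : ∀ n, divPow f n ∈ S) (hK : ((K1⁻¹ : Bˣ) : B) ∈ S) :
    monomialSpan d e f K1 K2 ≤ Subalgebra.toSubmodule S := by
  refine Submodule.span_le.2 ?_
  rintro _ ⟨⟨⟨a, b, b', c⟩, hb, -⟩, rfl⟩
  dsimp only at hb ⊢
  rw [monomial_eq e f K1 K2 hb, zp_natCast, zp_natCast]
  exact S.mul_mem (S.mul_mem (he a) (h.wt_mem S he hf hK (by omega))) (hf c)

theorem fullIntForm_eq_monomialSpan (h : SchurDatum d e f K1 K2) :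
    Subalgebra.toSubmodule (fullIntForm e f K1 K2) = monomialSpan d e f K1 K2 :=
  le_antisymm h.fullIntForm_le <| h.monomialSpan_le _
    (fun n => Algebra.subset_adjoin (.inl (.inl ⟨n, rfl⟩)))
    (fun n => Algebra.subset_adjoin (.inl (.inr ⟨n, rfl⟩))) (Algebra.subset_adjoin (.inr (by simp)))

theorem intForm_K1_eq (h : SchurDatum d e f K1 K2) : intForm e f K1 = fullIntForm e f K1 K2 := by
  refine le_antisymm (Algebra.adjoin_mono ?_) ?_
  · refine Set.union_subset_union_right _ ?_
    rintro x (rfl | rfl) <;> simp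
  · rw [← Subalgebra.toSubmodule.le_iff_le, h.fullIntForm_eq_monomialSpan]
    exact h.monomialSpan_le _
      (fun n => Algebra.subset_adjoin (.inl (.inl ⟨n, rfl⟩)))
      (fun n => Algebra.subset_adjoin (.inl (.inr ⟨n, rfl⟩)))
      (Algebra.subset_adjoin (.inr (by simp)))

theorem intForm_K2_eq (h : SchurDatum d e f K1 K2) : intForm e f K2 = fullIntForm e f K1 K2 := by
  refine le_antisymm (Algebra.adjoin_mono ?_) ?_
  · refine Set.union_subset_union_right _ ?_
    rintro x (rfl | rfl) <;> simp
  · rw [← Subalgebra.toSubmodule.le_iff_le, h.fullIntForm_eq_monomialSpan]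
    refine h.monomialSpan_le _
      (fun n => Algebra.subset_adjoin (.inl (.inl ⟨n, rfl⟩)))
      (fun n => Algebra.subset_adjoin (.inl (.inr ⟨n, rfl⟩))) ?_
    rw [h.K1_inv_eq]
    exact smul_mem_subalgebra (v_zpow_mem _) _ (Algebra.subset_adjoin (.inr (by simp)))

/-- The monomials span an algebra generated by `e`, `f`, `K₁`, `K₂` and their inverses. -/
theorem span_monomial_eq_top (h : SchurDatum d e f K1 K2)
    (hgen : Algebra.adjoin Qv ({e, f, (K1 : B), ((K1⁻¹ : Bˣ) : B), (K2 : B), ((K2⁻¹ : Bˣ) : B)} :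
      Set B) = ⊤) :
    Submodule.span Qv (Set.range fun p : Idx1 d => monomial e f K1 K2 p) = ⊤ := by
  rw [eq_top_iff, ← Algebra.top_toSubmodule, ← hgen, Algebra.adjoin_eq_span, Submodule.span_le]
  have h1 (x : B) : divPow x 1 = x := by simp [divPow, qFact]
  -- Words in the generators already lie in the integral form, so the integral spanning result gives
  -- the one over `ℚ(v)`.
  have hle : Submonoid.closure ({e, f, (K1 : B), ((K1⁻¹ : Bˣ) : B), (K2 : B), ((K2⁻¹ : Bˣ) : B)} :
      Set B) ≤ (fullIntForm e f K1 K2).toSubmonoid := by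
    rw [Submonoid.closure_le]
    rintro x (rfl | rfl | hx)
    · exact Algebra.subset_adjoin (.inl (.inl ⟨1, h1 _⟩))
    · exact Algebra.subset_adjoin (.inl (.inr ⟨1, h1 _⟩))
    · exact Algebra.subset_adjoin (.inr hx)
  intro x hx
  have h2 : x ∈ monomialSpan d e f K1 K2 := h.fullIntForm_le (hle hx)
  exact Submodule.span_le_restrictScalars LaurentZ Qv _ h2

end SchurDatum

/-! ### Compatibility with algebra homomorphisms. -/

section Maps

variable {B C : Type*} [Ring B] [Algebra Qv B] [Ring C] [Algebra Qv C]

theorem map_divPow (φ : B →ₐ[Qv] C) (x : B) (n : ℕ) : φ (divPow x n) = divPow (φ x) n := by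
  simp [divPow]

theorem map_qBinom (φ : B →ₐ[Qv] C) (k : Bˣ) (t : ℕ) :
    φ (qBinom k t) = qBinom (Units.map (φ : B →* C) k) t := by
  rw [qBinom, qBinom, map_list_prod, List.map_map]
  congr 2
  funext j
  simp

theorem map_monomial (φ : B →ₐ[Qv] C) (x y : B) (K1 K2 : Bˣ) (p : ℕ × ℕ × ℕ × ℕ) :
    φ (monomial x y K1 K2 p) = monomial (φ x) (φ y) (Units.map (φ : B →* C) K1)
      (Units.map (φ : B →* C) K2) p := by
  simp only [monomial, map_mul, map_divPow, map_qBinom]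

variable [Algebra LaurentZ B] [IsScalarTower LaurentZ Qv B]
  [Algebra LaurentZ C] [IsScalarTower LaurentZ Qv C]

theorem map_intForm (φ : B →ₐ[Qv] C) (e f : B) (K : Bˣ) :
    (intForm e f K).map (φ.restrictScalars LaurentZ) =
      intForm (φ e) (φ f) (Units.map (φ : B →* C) K) := by
  rw [intForm, intForm, AlgHom.map_adjoin, Set.image_union, Set.image_union, ← Set.range_comp,
    ← Set.range_comp, Set.image_pair]
  congr 3 <;> congr 1 <;> funext n <;> simp [map_divPow]

theorem map_fullIntForm (φ : B →ₐ[Qv] C) (e f : B) (K1 K2 : Bˣ) :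
    (SchurDatum.fullIntForm e f K1 K2).map (φ.restrictScalars LaurentZ) =
      SchurDatum.fullIntForm (φ e) (φ f) (Units.map (φ : B →* C) K1)
        (Units.map (φ : B →* C) K2) := by
  rw [SchurDatum.fullIntForm, SchurDatum.fullIntForm, AlgHom.map_adjoin, Set.image_union,
    Set.image_union, ← Set.range_comp, ← Set.range_comp, Set.image_insert_eq, Set.image_insert_eq,
    Set.image_pair]
  congr 3 <;> congr 1 <;> funext n <;> simp [map_divPow]

end Maps

/-! ### The action on tensor powers -/

section TensorPower

variable {d : ℕ}

/-- The standard basis vectors of the natural module. -/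
def bas (i : Fin 2) : E := Pi.single i 1

/-- The vector `x ⊗ y` of `E^{⊗ (d + 1)}`, bilinearly in `x` and `y`. -/
def snoc (x : TE d) (y : E) : TE (d + 1) := snocEquiv d (x ⊗ₜ y)

theorem snoc_add_left (x x' : TE d) (y : E) : snoc (x + x') y = snoc x y + snoc x' y := by
  simp [snoc, TensorProduct.add_tmul]

theorem snoc_add_right (x : TE d) (y y' : E) : snoc x (y + y') = snoc x y + snoc x y' := by
  simp [snoc, TensorProduct.tmul_add]

theorem snoc_smul_left (q : Qv) (x : TE d) (y : E) : snoc (q • x) y = q • snoc x y := by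
  rw [snoc, ← TensorProduct.smul_tmul', map_smul, snoc]

theorem snoc_smul_right (q : Qv) (x : TE d) (y : E) : snoc x (q • y) = q • snoc x y := by
  simp [snoc]

@[simp] theorem snoc_zero_left (y : E) : snoc (0 : TE d) y = 0 := by simp [snoc]

@[simp] theorem snoc_zero_right (x : TE d) : snoc x 0 = 0 := by simp [snoc]

theorem eq_bas (y : E) : y = y 0 • bas 0 + y 1 • bas 1 := by
  ext i; fin_cases i <;> simp [bas]

theorem span_snoc {M : Submodule Qv (TE (d + 1))} {s : Set (TE d)}
    (hs : Submodule.span Qv s = ⊤) (h : ∀ x ∈ s, ∀ i, snoc x (bas i) ∈ M) : M = ⊤ := by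
  rw [eq_top_iff]
  rintro z -
  obtain ⟨w, rfl⟩ := (snocEquiv d).surjective z
  induction w using TensorProduct.induction_on with
  | zero => rw [map_zero]; exact zero_mem _
  | add w w' hw hw' => rw [map_add]; exact add_mem hw hw'
  | tmul x y =>
    have hx : x ∈ Submodule.span Qv s := hs ▸ Submodule.mem_top
    change snoc x y ∈ M
    induction hx using Submodule.span_induction with
    | mem x hx =>
      rw [eq_bas y, snoc_add_right, snoc_smul_right, snoc_smul_right]
      exact add_mem (M.smul_mem _ (h x hx 0)) (M.smul_mem _ (h x hx 1))
    | zero => rw [snoc_zero_left]; exact zero_mem _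
    | add x x' _ _ hx hx' => rw [snoc_add_left]; exact add_mem hx hx'
    | smul q x _ hx => rw [snoc_smul_left]; exact M.smul_mem _ hx

theorem end_ext {A B : Module.End Qv (TE (d + 1))}
    (h : ∀ x i, A (snoc x (bas i)) = B (snoc x (bas i))) : A = B := by
  have h1 : LinearMap.eqLocus A B = ⊤ :=
    span_snoc (s := Set.univ) Submodule.span_univ fun x _ i => h x i
  exact LinearMap.eqLocus_eq_top.1 h1

theorem rhoPow_succ_snoc {u : Uq} {ι : Type} (s : Finset ι) (p q : ι → Uq)
    (hu : Uq.comul u = ∑ i ∈ s, p i ⊗ₜ q i) (x : TE d) (y : E) :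
    rhoPow (d + 1) u (snoc x y) = ∑ i ∈ s, snoc (rhoPow d (p i) x) (rho (q i) y) := by
  change (snocEquiv d).conjAlgEquiv Qv (Module.endTensorEndAlgHom (R := Qv) (A := Qv)
    (Algebra.TensorProduct.map (rhoPow d) rho (Uq.comul u))) (snocEquiv d (x ⊗ₜ y)) = _
  rw [hu, LinearEquiv.conjAlgEquiv_apply]
  simp [snoc, map_sum, Module.endTensorEndAlgHom_apply]

theorem comul_gen (g : UGen) : Uq.comul (Uq.gen g) = Uq.comulGen g := by
  simp [Uq.comul, Uq.gen]

theorem rhoPow_e_snoc (x : TE d) (y : E) : rhoPow (d + 1) Uq.e (snoc x y) =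
    snoc (rhoPow d Uq.e x) y + snoc (rhoPow d (Uq.K : Uq) x) (rho Uq.e y) := by
  rw [rhoPow_succ_snoc (Finset.univ : Finset (Fin 2)) ![Uq.e, (Uq.K : Uq)] ![1, Uq.e]
    (by rw [Fin.sum_univ_two]; exact comul_gen .e)]
  simp

theorem rhoPow_f_snoc (x : TE d) (y : E) : rhoPow (d + 1) Uq.f (snoc x y) =
    snoc (rhoPow d Uq.f x) (rho ((Uq.K⁻¹ : Uqˣ) : Uq) y) + snoc x (rho Uq.f y) := by
  rw [rhoPow_succ_snoc (Finset.univ : Finset (Fin 2)) ![Uq.f, 1] ![((Uq.K⁻¹ : Uqˣ) : Uq), Uq.f]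
    (by rw [Fin.sum_univ_two]; exact comul_gen .f)]
  simp

theorem rhoPow_K1_snoc (x : TE d) (y : E) : rhoPow (d + 1) (Uq.K1 : Uq) (snoc x y) =
    snoc (rhoPow d (Uq.K1 : Uq) x) (rho (Uq.K1 : Uq) y) := by
  rw [rhoPow_succ_snoc (Finset.univ : Finset (Fin 1)) ![(Uq.K1 : Uq)] ![(Uq.K1 : Uq)]
    (by rw [Fin.sum_univ_one]; exact comul_gen .K1)]
  simp

theorem rhoPow_K2_snoc (x : TE d) (y : E) : rhoPow (d + 1) (Uq.K2 : Uq) (snoc x y) =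
    snoc (rhoPow d (Uq.K2 : Uq) x) (rho (Uq.K2 : Uq) y) := by
  rw [rhoPow_succ_snoc (Finset.univ : Finset (Fin 1)) ![(Uq.K2 : Uq)] ![(Uq.K2 : Uq)]
    (by rw [Fin.sum_univ_one]; exact comul_gen .K2)]
  simp

theorem rho_gen (g : UGen) : rho (Uq.gen g) = Matrix.toLinAlgEquiv' (match g with
      | .e => !![0, 1; 0, 0]
      | .f => !![0, 0; 1, 0]
      | .K1 => !![v, 0; 0, 1]
      | .K1' => !![v⁻¹, 0; 0, 1]
      | .K2 => !![1, 0; 0, v]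
      | .K2' => !![1, 0; 0, v⁻¹]) := by
  cases g <;> simp [rho, Uq.gen]

theorem rho_e_zero : rho Uq.e (bas 0) = 0 := by
  rw [Uq.e, rho_gen]; ext i; fin_cases i <;> simp [bas, Matrix.toLinAlgEquiv'_apply]

theorem rho_e_one : rho Uq.e (bas 1) = bas 0 := by
  rw [Uq.e, rho_gen]; ext i; fin_cases i <;> simp [bas, Matrix.toLinAlgEquiv'_apply]

theorem rho_f_zero : rho Uq.f (bas 0) = bas 1 := by
  rw [Uq.f, rho_gen]; ext i; fin_cases i <;> simp [bas, Matrix.toLinAlgEquiv'_apply]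

theorem rho_f_one : rho Uq.f (bas 1) = 0 := by
  rw [Uq.f, rho_gen]; ext i; fin_cases i <;> simp [bas, Matrix.toLinAlgEquiv'_apply]

theorem rho_K1_zero : rho (Uq.K1 : Uq) (bas 0) = v • bas 0 := by
  change rho (Uq.gen .K1) _ = _
  rw [rho_gen]; ext i; fin_cases i <;> simp [bas, Matrix.toLinAlgEquiv'_apply]

theorem rho_K1_one : rho (Uq.K1 : Uq) (bas 1) = bas 1 := by
  change rho (Uq.gen .K1) _ = _
  rw [rho_gen]; ext i; fin_cases i <;> simp [bas, Matrix.toLinAlgEquiv'_apply]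

theorem rho_K2_zero : rho (Uq.K2 : Uq) (bas 0) = bas 0 := by
  change rho (Uq.gen .K2) _ = _
  rw [rho_gen]; ext i; fin_cases i <;> simp [bas, Matrix.toLinAlgEquiv'_apply]

theorem rho_K2_one : rho (Uq.K2 : Uq) (bas 1) = v • bas 1 := by
  change rho (Uq.gen .K2) _ = _
  rw [rho_gen]; ext i; fin_cases i <;> simp [bas, Matrix.toLinAlgEquiv'_apply]

theorem rho_Kinv (y : E) :
    rho ((Uq.K⁻¹ : Uqˣ) : Uq) y = rho (Uq.K2 : Uq) (rho (Uq.gen .K1') y) := by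
  rw [Uq.K, mul_inv_rev, inv_inv, Units.val_mul, map_mul]; rfl

theorem rho_Kinv_zero : rho ((Uq.K⁻¹ : Uqˣ) : Uq) (bas 0) = v⁻¹ • bas 0 := by
  have h : rho (Uq.gen .K1') (bas 0) = v⁻¹ • bas 0 := by
    rw [rho_gen]; ext i; fin_cases i <;> simp [bas, Matrix.toLinAlgEquiv'_apply]
  rw [rho_Kinv, h, map_smul, rho_K2_zero]

theorem rho_Kinv_one : rho ((Uq.K⁻¹ : Uqˣ) : Uq) (bas 1) = v • bas 1 := by
  have h : rho (Uq.gen .K1') (bas 1) = bas 1 := by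
    rw [rho_gen]; ext i; fin_cases i <;> simp [bas, Matrix.toLinAlgEquiv'_apply]
  rw [rho_Kinv, h, rho_K2_one]

theorem rhoPow_zero_apply (u : Uq) (x : TE 0) : rhoPow 0 u x = Uq.counit u • x := rfl

theorem counit_gen (g : UGen) : Uq.counit (Uq.gen g) = match g with
    | .e => 0
    | .f => 0
    | .K1 => 1
    | .K1' => 1
    | .K2 => 1
    | .K2' => 1 := by
  cases g <;> simp [Uq.counit, Uq.gen]

/-- The vectors of weight `m`. -/
def IsWeight (d : ℕ) (m : ℤ) (x : TE d) : Prop := rhoPow d (Uq.K1 : Uq) x = v ^ m • x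

theorem IsWeight.snoc_zero {m : ℤ} {x : TE d} (h : IsWeight d m x) :
    IsWeight (d + 1) (m + 1) (snoc x (bas 0)) := by
  rw [IsWeight, rhoPow_K1_snoc, h, rho_K1_zero, snoc_smul_left, snoc_smul_right, smul_smul,
    zpow_add₀ v_ne_zero, zpow_one]

theorem IsWeight.snoc_one {m : ℤ} {x : TE d} (h : IsWeight d m x) :
    IsWeight (d + 1) m (snoc x (bas 1)) := by
  rw [IsWeight, rhoPow_K1_snoc, h, rho_K1_one, snoc_smul_left]

/-- Appending `bas 0` raises the weight by one and appending `bas 1` keeps it, so by induction the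
weights stay between 0 and `d`. -/
theorem span_isWeight (d : ℕ) :
    Submodule.span Qv {x : TE d | ∃ j : ℕ, j ≤ d ∧ IsWeight d j x} = ⊤ := by
  induction d with
  | zero =>
    refine eq_top_iff.2 fun x _ => Submodule.subset_span ⟨0, le_rfl, ?_⟩
    have h1 : Uq.counit (Uq.K1 : Uq) = 1 := counit_gen .K1
    rw [IsWeight, rhoPow_zero_apply, h1]
    simp
  | succ d ih =>
    refine span_snoc ih ?_
    rintro x ⟨j, hj, hx⟩ i
    refine Submodule.subset_span ?_
    fin_cases i
    · exact ⟨j + 1, by omega, by simpa using hx.snoc_zero⟩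
    · exact ⟨j, by omega, by simpa using hx.snoc_one⟩

theorem rhoPow_K1_mul_K2 (d : ℕ) :
    rhoPow d ((Uq.K1 : Uq) * Uq.K2) = algebraMap Qv _ (v ^ d) := by
  induction d with
  | zero =>
    ext x
    have h1 : Uq.counit (Uq.K1 : Uq) = 1 := counit_gen .K1
    have h2 : Uq.counit (Uq.K2 : Uq) = 1 := counit_gen .K2
    rw [rhoPow_zero_apply, map_mul, h1, h2]
    simp
  | succ d ih =>
    rw [map_mul] at ih ⊢
    have h (x : TE d) : rhoPow d (Uq.K1 : Uq) (rhoPow d (Uq.K2 : Uq) x) = v ^ d • x := by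
      rw [← Module.End.mul_apply, ih, Module.algebraMap_end_apply]
    refine end_ext fun x i => ?_
    rw [Module.End.mul_apply, rhoPow_K2_snoc, Module.algebraMap_end_apply]
    fin_cases i
    · simp only [Fin.zero_eta]
      rw [rho_K2_zero, rhoPow_K1_snoc, h, rho_K1_zero, snoc_smul_left, snoc_smul_right, smul_smul,
        pow_succ]
    · simp only [Fin.mk_one]
      rw [rho_K2_one, snoc_smul_right, map_smul, rhoPow_K1_snoc, h, rho_K1_one, snoc_smul_left,
        smul_smul, pow_succ']

end TensorPower

/-! ### Minimal polynomials and weight decompositions -/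

section Minpoly

variable {B : Type*} [Ring B] [Algebra Qv B]

theorem list_prod_eq_aeval (k : B) (n : ℕ) :
    ((List.range n).map fun i => k - algebraMap Qv B (v ^ i)).prod =
      Polynomial.aeval k (Lagrange.nodal (Finset.range n) fun i => v ^ i) := by
  induction n with
  | zero => simp
  | succ n ih =>
    rw [List.range_succ, List.map_append, List.prod_append, ih, Lagrange.nodal, Lagrange.nodal,
      Finset.prod_range_succ, map_mul]
    simp

/-- Lagrange interpolation at the nodes `v ^ i`: the basis polynomials sum to 1, and `X - v ^ j`
times the `j`-th one is a scalar multiple of the nodal polynomial, which vanishes at `k`. -/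
theorem exists_decomp_of_minpoly {k : B} {d : ℕ}
    (h : ((List.range (d + 1)).map fun i => k - algebraMap Qv B (v ^ i)).prod = 0) :
    ∃ L : ℕ → B, ∑ j ∈ Finset.range (d + 1), L j = 1 ∧ ∀ j ≤ d, k * L j = v ^ (j : ℤ) • L j := by
  have hinj : Set.InjOn (fun i : ℕ => v ^ i) (Finset.range (d + 1)) := by
    intro i _ j _ hij
    have := @v_zpow_injective i j (by simpa using hij)
    exact_mod_cast this
  refine ⟨fun j => Polynomial.aeval k
    (Lagrange.basis (Finset.range (d + 1)) (fun i => v ^ i) j), ?_, fun j hj => ?_⟩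
  · rw [← map_sum, Lagrange.sum_basis hinj ⟨0, by simp⟩, map_one]
  · rw [list_prod_eq_aeval] at h
    have hj' : j ∈ Finset.range (d + 1) := Finset.mem_range.2 (by omega)
    have h1 : (Polynomial.X - Polynomial.C (v ^ j)) *
        Lagrange.basis (Finset.range (d + 1)) (fun i => v ^ i) j =
        Polynomial.C (Lagrange.nodalWeight (Finset.range (d + 1)) (fun i => v ^ i) j) *
          Lagrange.nodal (Finset.range (d + 1)) fun i => v ^ i := by
      rw [Lagrange.basis_eq_prod_sub_inv_mul_nodal_div hj', ← Lagrange.nodal_erase_eq_nodal_div hj',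
        Lagrange.nodal_eq_mul_nodal_erase hj']
      ring
    have h2 := congrArg (Polynomial.aeval k) h1
    rw [map_mul, map_mul, h, mul_zero, map_sub, Polynomial.aeval_X, Polynomial.aeval_C, sub_mul,
      sub_eq_zero, ← Algebra.smul_def] at h2
    rw [h2, zpow_natCast]

theorem list_prod_mul_of_weight {M : Type*} [AddCommGroup M] [Module Qv M] [Module B M]
    [IsScalarTower Qv B M] {k : B} {x : M} {j : ℕ} (hx : k • x = v ^ j • x) (n : ℕ) :
    ((List.range n).map fun i => k - algebraMap Qv B (v ^ i)).prod • x =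
      (∏ i ∈ Finset.range n, (v ^ j - v ^ i)) • x := by
  induction n with
  | zero => simp
  | succ n ih =>
    have hc : ∀ (b : B) (q : Qv), b • q • x = q • b • x := fun b q => by
      rw [← algebraMap_smul B q x, ← mul_smul, ← Algebra.commutes, mul_smul, algebraMap_smul]
    rw [List.range_succ, List.map_append, List.prod_append, Finset.prod_range_succ,
      List.map_singleton, List.prod_singleton, mul_smul, sub_smul, algebraMap_smul, hx, ← sub_smul,
      hc, ih, smul_smul, mul_comm]

theorem list_prod_smul_eq_zero {M : Type*} [AddCommGroup M] [Module Qv M] [Module B M]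
    [IsScalarTower Qv B M] {k : B} {x : M} {d j : ℕ} (hj : j ≤ d) (hx : k • x = v ^ j • x) :
    ((List.range (d + 1)).map fun i => k - algebraMap Qv B (v ^ i)).prod • x = 0 := by
  rw [list_prod_mul_of_weight hx, Finset.prod_eq_zero (Finset.mem_range.2 (show j < d + 1 by omega))
    (sub_self _), zero_smul]

theorem SchurDatum.minpoly {d : ℕ} {e f : B} {K1 K2 : Bˣ} (h : SchurDatum d e f K1 K2) :
    ((List.range (d + 1)).map fun i => (K1 : B) - algebraMap Qv B (v ^ i)).prod = 0 := by
  obtain ⟨L, hL, hw⟩ := h.decomp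
  rw [← mul_one (List.prod _), ← hL, Finset.mul_sum]
  refine Finset.sum_eq_zero fun j hj => ?_
  have hj' : j ≤ d := by simpa [Nat.lt_succ_iff] using hj
  exact list_prod_smul_eq_zero (B := B) (x := L j) hj'
    (by rw [smul_eq_mul, hw j hj', zpow_natCast])

end Minpoly

/-! ### The Schur algebra is a Schur datum. -/

section SvDatum

variable (d : ℕ)

theorem Sv.coe_K1 : ((Sv.K1 d : Sv d)) = Sv.proj d (Uq.K1 : Uq) := rfl

theorem Sv.coe_K2 : ((Sv.K2 d : Sv d)) = Sv.proj d (Uq.K2 : Uq) := rfl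

theorem Sv.coe_K1_inv : (((Sv.K1 d)⁻¹ : (Sv d)ˣ) : Sv d) = Sv.proj d ((Uq.K1⁻¹ : Uqˣ) : Uq) := rfl

theorem Sv.coe_K2_inv : (((Sv.K2 d)⁻¹ : (Sv d)ˣ) : Sv d) = Sv.proj d ((Uq.K2⁻¹ : Uqˣ) : Uq) := rfl

theorem Sv.minpoly : ((List.range (d + 1)).map fun i =>
    (Sv.K1 d : Sv d) - algebraMap Qv (Sv d) (v ^ i)).prod = 0 := by
  have h : ((List.range (d + 1)).map fun i => rhoPow d (Uq.K1 : Uq) -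
      algebraMap Qv (Module.End Qv (TE d)) (v ^ i)).prod = 0 := by
    refine LinearMap.ext_on (span_isWeight d) ?_
    rintro x ⟨j, hj, hx⟩
    rw [IsWeight, zpow_natCast] at hx
    exact list_prod_smul_eq_zero (B := Module.End Qv (TE d)) hj hx
  apply Subtype.ext
  change (Sv d).val _ = _
  rw [map_list_prod, List.map_map]
  exact h

theorem Sv.schurDatum : SchurDatum d (Sv.e d) (Sv.f d) (Sv.K1 d) (Sv.K2 d) where
  mul_eq := by
    rw [coe_K1, coe_K2, ← map_mul]
    exact Subtype.ext (rhoPow_K1_mul_K2 d)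
  K1_e := by rw [coe_K1, e, ← map_mul, Uq.K1_e, map_smul, map_mul]
  K1_f := by rw [coe_K1, f, ← map_mul, Uq.K1_f, map_smul, map_mul]
  K2_e := by rw [coe_K2, e, ← map_mul, Uq.K2_e, map_smul, map_mul]
  K2_f := by rw [coe_K2, f, ← map_mul, Uq.K2_f, map_smul, map_mul]
  e_f := by
    have hK : Uq.K⁻¹ = Uq.K1⁻¹ * Uq.K2 := by
      rw [Uq.K, mul_inv_rev, inv_inv]; exact (Uq.commute_K.symm.inv_right).eq
    have h := Uq.e_f
    rw [hK, Uq.K, Units.val_mul, Units.val_mul] at h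
    rw [coe_K1, coe_K2, coe_K1_inv, coe_K2_inv, e, f]
    simp only [← map_mul, ← map_sub, h, map_smul]
  decomp := exists_decomp_of_minpoly (Sv.minpoly d)

end SvDatum

/-! ### Separation of the monomials by matrix coefficients -/

section Separation

variable {d : ℕ}

theorem IsWeight.K {m : ℤ} {x : TE d} (h : IsWeight d m x) :
    rhoPow d (Uq.K : Uq) x = v ^ (2 * m - d) • x := by
  have h1 : rhoPow d (Uq.K2 : Uq) (rhoPow d (Uq.K1 : Uq) x) = v ^ d • x := by
    rw [← Module.End.mul_apply, ← map_mul, ← Units.val_mul, ← Uq.commute_K.eq, Units.val_mul,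
      rhoPow_K1_mul_K2, Module.algebraMap_end_apply]
  rw [h, map_smul] at h1
  have h2 : rhoPow d (Uq.K : Uq) (rhoPow d (Uq.K2 : Uq) x) = v ^ m • x := by
    rw [← h, ← Module.End.mul_apply, ← map_mul, ← Units.val_mul, Uq.K, inv_mul_cancel_right]
  have h3 : rhoPow d (Uq.K2 : Uq) x = v ^ (d - m) • x := by
    rw [sub_eq_neg_add, zpow_add₀ v_ne_zero, mul_smul, zpow_natCast, ← h1, smul_smul,
      ← zpow_add₀ v_ne_zero]
    simp
  rw [h3, map_smul] at h2
  rw [show 2 * m - (d : ℤ) = -(d - m) + m by ring, zpow_add₀ v_ne_zero, mul_smul, ← h2, smul_smul,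
    ← zpow_add₀ v_ne_zero]
  simp

theorem IsWeight.zp_e {m : ℤ} {x : TE d} (h : IsWeight d m x) (n : ℤ) :
    IsWeight d (m + n) (rhoPow d (zp Uq.e n) x) := by
  rw [IsWeight, ← Module.End.mul_apply, ← map_mul,
    mul_zp_of_weight (s := 1) (by simpa using Uq.K1_e), map_smul, map_mul, LinearMap.smul_apply,
    Module.End.mul_apply, h, map_smul, smul_smul, ← zpow_add₀ v_ne_zero, one_mul, add_comm]

theorem IsWeight.zp_f {m : ℤ} {x : TE d} (h : IsWeight d m x) (n : ℤ) :
    IsWeight d (m - n) (rhoPow d (zp Uq.f n) x) := by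
  rw [IsWeight, ← Module.End.mul_apply, ← map_mul,
    mul_zp_of_weight (s := -1) (by simpa using Uq.K1_f), map_smul, map_mul, LinearMap.smul_apply,
    Module.End.mul_apply, h, map_smul, smul_smul, ← zpow_add₀ v_ne_zero, neg_one_mul, add_comm,
    ← sub_eq_add_neg]

theorem rhoPow_mul_zp (u : Uq) (n : ℤ) (x : TE d) :
    rhoPow d u (rhoPow d (zp u n) x) = qInt (n + 1) • rhoPow d (zp u (n + 1)) x := by
  rw [← Module.End.mul_apply, ← map_mul, mul_zp, map_smul, LinearMap.smul_apply]

/-- Only two terms appear because `f` acts on `E` with square zero. The induction step rests on `[n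
+ 1] = v [n] + v ^ (-n)`. -/
theorem zp_f_snoc_zero (x : TE d) (n : ℤ) :
    rhoPow (d + 1) (zp Uq.f n) (snoc x (bas 0)) =
      v ^ (-n) • snoc (rhoPow d (zp Uq.f n) x) (bas 0) +
        snoc (rhoPow d (zp Uq.f (n - 1)) x) (bas 1) := by
  by_cases hn : n < 0
  · simp [zp_of_neg Uq.f hn, zp_of_neg Uq.f (show n - 1 < 0 by omega)]
  obtain ⟨n, rfl⟩ := Int.eq_ofNat_of_zero_le (not_lt.1 hn)
  clear hn
  induction n with
  | zero => simp [zp_of_neg Uq.f (show (-1 : ℤ) < 0 by norm_num)]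
  | succ n ih =>
    have hq : qInt ((n : ℤ) + 1) ≠ 0 := qInt_ne_zero (by omega)
    have h1 := rhoPow_mul_zp Uq.f ((n : ℤ) - 1) x
    rw [sub_add_cancel] at h1
    refine smul_right_injective _ hq ?_
    dsimp only
    rw [Nat.cast_succ, ← rhoPow_mul_zp, ih, map_add, map_smul, rhoPow_f_snoc, rhoPow_f_snoc,
      rho_Kinv_zero, rho_Kinv_one, rho_f_zero, rho_f_one, rhoPow_mul_zp, h1, add_sub_cancel_right]
    simp only [snoc_smul_left, snoc_smul_right, snoc_zero_right, smul_add, smul_smul, add_zero]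
    have h2 := qInt_add n 1
    rw [qInt_one, mul_one, zpow_one] at h2
    have h3 : v ^ (-((n : ℤ) + 1)) = v ^ (-(n : ℤ)) * v⁻¹ := by
      rw [neg_add, zpow_add₀ v_ne_zero, zpow_neg_one]
    rw [h3, h2]
    module

theorem zp_f_snoc_one (x : TE d) (n : ℤ) :
    rhoPow (d + 1) (zp Uq.f n) (snoc x (bas 1)) =
      v ^ n • snoc (rhoPow d (zp Uq.f n) x) (bas 1) := by
  by_cases hn : n < 0
  · simp [zp_of_neg Uq.f hn]
  obtain ⟨n, rfl⟩ := Int.eq_ofNat_of_zero_le (not_lt.1 hn)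
  clear hn
  induction n with
  | zero => simp
  | succ n ih =>
    have hq : qInt ((n : ℤ) + 1) ≠ 0 := qInt_ne_zero (by omega)
    refine smul_right_injective _ hq ?_
    dsimp only
    rw [Nat.cast_succ, ← rhoPow_mul_zp, ih, map_smul, rhoPow_f_snoc, rho_Kinv_one, rho_f_one,
      rhoPow_mul_zp, zpow_add₀ v_ne_zero, zpow_one]
    simp only [snoc_smul_left, snoc_smul_right, snoc_zero_right, add_zero]
    module

theorem zp_e_snoc_zero (x : TE d) (n : ℤ) :
    rhoPow (d + 1) (zp Uq.e n) (snoc x (bas 0)) = snoc (rhoPow d (zp Uq.e n) x) (bas 0) := by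
  by_cases hn : n < 0
  · simp [zp_of_neg Uq.e hn]
  obtain ⟨n, rfl⟩ := Int.eq_ofNat_of_zero_le (not_lt.1 hn)
  clear hn
  induction n with
  | zero => simp
  | succ n ih =>
    have hq : qInt ((n : ℤ) + 1) ≠ 0 := qInt_ne_zero (by omega)
    refine smul_right_injective _ hq ?_
    dsimp only
    rw [Nat.cast_succ, ← rhoPow_mul_zp, ih, rhoPow_e_snoc, rho_e_zero, rhoPow_mul_zp,
      snoc_smul_left, snoc_zero_right, add_zero]

theorem zp_e_snoc_one {m : ℤ} {x : TE d} (hx : IsWeight d m x) (n : ℤ) :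
    rhoPow (d + 1) (zp Uq.e n) (snoc x (bas 1)) =
      snoc (rhoPow d (zp Uq.e n) x) (bas 1) +
        v ^ (2 * m - d + n - 1) • snoc (rhoPow d (zp Uq.e (n - 1)) x) (bas 0) := by
  by_cases hn : n < 0
  · simp [zp_of_neg Uq.e hn, zp_of_neg Uq.e (show n - 1 < 0 by omega)]
  obtain ⟨n, rfl⟩ := Int.eq_ofNat_of_zero_le (not_lt.1 hn)
  clear hn
  induction n with
  | zero => simp [zp_of_neg Uq.e (show (-1 : ℤ) < 0 by norm_num)]
  | succ n ih =>
    have hq : qInt ((n : ℤ) + 1) ≠ 0 := qInt_ne_zero (by omega)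
    have h1 := rhoPow_mul_zp Uq.e ((n : ℤ) - 1) x
    rw [sub_add_cancel] at h1
    refine smul_right_injective _ hq ?_
    dsimp only
    rw [Nat.cast_succ, ← rhoPow_mul_zp, ih, map_add, map_smul, rhoPow_e_snoc, rhoPow_e_snoc,
      rho_e_zero, rho_e_one, rhoPow_mul_zp, (hx.zp_e n).K, h1, add_sub_cancel_right]
    simp only [snoc_smul_left, snoc_zero_right, add_zero, smul_add, smul_smul]
    have h2 := qInt_add 1 n
    rw [qInt_one, mul_one, add_comm] at h2
    rw [h2, show 2 * (m + (n : ℤ)) - d = (2 * m - d + n) + n by ring,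
      show 2 * m - (d : ℤ) + (n + 1) - 1 = 2 * m - d + n by ring, zpow_add₀ v_ne_zero _ (n : ℤ),
      zpow_sub₀ v_ne_zero, zpow_one, zpow_neg_one]
    module

/-- The functional `lam ⊗ bas i ^*` on `E^{⊗ (d + 1)}`. -/
def snocDual (lam : TE d →ₗ[Qv] Qv) (i : Fin 2) : TE (d + 1) →ₗ[Qv] Qv :=
  (TensorProduct.lid Qv Qv).toLinearMap ∘ₗ TensorProduct.map lam (LinearMap.proj i) ∘ₗ
    (snocEquiv d).symm.toLinearMap

theorem snocDual_snoc (lam : TE d →ₗ[Qv] Qv) (i : Fin 2) (x : TE d) (y : E) :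
    snocDual lam i (snoc x y) = lam x * y i := by
  simp [snocDual, snoc]

variable (d) in
/-- A vector `x` of weight `b + c` and a functional `lam` detect `e^(a) f^(c)`: the matrix
coefficient of `e^(a') f^(c')` vanishes if `a' < a` or `c' < c`, but not for `(a', c') = (a, c)`. -/
def Separates (a b c : ℤ) (x : TE d) (lam : TE d →ₗ[Qv] Qv) : Prop :=
  IsWeight d (b + c) x ∧
    (∀ a' c' : ℤ, a' < a ∨ c' < c → lam (rhoPow d (zp Uq.e a') (rhoPow d (zp Uq.f c') x)) = 0) ∧
    lam (rhoPow d (zp Uq.e a) (rhoPow d (zp Uq.f c) x)) ≠ 0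

theorem snoc_zero_formula {m : ℤ} {x : TE d} (hx : IsWeight d m x) (a c : ℤ) :
    rhoPow (d + 1) (zp Uq.e a) (rhoPow (d + 1) (zp Uq.f c) (snoc x (bas 0))) =
      v ^ (-c) • snoc (rhoPow d (zp Uq.e a) (rhoPow d (zp Uq.f c) x)) (bas 0) +
      (snoc (rhoPow d (zp Uq.e a) (rhoPow d (zp Uq.f (c - 1)) x)) (bas 1) +
        v ^ (2 * (m - (c - 1)) - d + a - 1) •
          snoc (rhoPow d (zp Uq.e (a - 1)) (rhoPow d (zp Uq.f (c - 1)) x)) (bas 0)) := by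
  rw [zp_f_snoc_zero, map_add, map_smul, zp_e_snoc_zero, zp_e_snoc_one (hx.zp_f _)]

theorem snoc_one_formula {m : ℤ} {x : TE d} (hx : IsWeight d m x) (a c : ℤ) :
    rhoPow (d + 1) (zp Uq.e a) (rhoPow (d + 1) (zp Uq.f c) (snoc x (bas 1))) =
      v ^ c • (snoc (rhoPow d (zp Uq.e a) (rhoPow d (zp Uq.f c) x)) (bas 1) +
        v ^ (2 * (m - c) - d + a - 1) •
          snoc (rhoPow d (zp Uq.e (a - 1)) (rhoPow d (zp Uq.f c) x)) (bas 0)) := by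
  rw [zp_f_snoc_one, map_smul, zp_e_snoc_one (hx.zp_f _)]

/-- The `bas 0` coordinate contains a second term, with exponents `a - 1` and `c - 1`, but `lam`
already kills it. -/
theorem Separates.zero_zero {a b c : ℤ} {x : TE d} {lam : TE d →ₗ[Qv] Qv}
    (h : Separates d a b c x lam) :
    Separates (d + 1) a (b + 1) c (snoc x (bas 0)) (snocDual lam 0) := by
  obtain ⟨hx, h0, h1⟩ := h
  refine ⟨by simpa [add_right_comm] using hx.snoc_zero, fun a' c' h => ?_, ?_⟩
  · rw [snoc_zero_formula hx]
    simp [snocDual_snoc, bas, h0 a' c' h, h0 (a' - 1) (c' - 1) (by omega)]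
  · rw [snoc_zero_formula hx]
    simp [snocDual_snoc, bas, h0 (a - 1) (c - 1) (by omega), h1, zpow_ne_zero, v_ne_zero]

/-- The `bas 1` coordinate sees only the term in which one `f` has acted on the last factor, so the
exponent of `f` moves up by one. -/
theorem Separates.zero_one {a b c : ℤ} {x : TE d} {lam : TE d →ₗ[Qv] Qv}
    (h : Separates d a b c x lam) :
    Separates (d + 1) a b (c + 1) (snoc x (bas 0)) (snocDual lam 1) := by
  obtain ⟨hx, h0, h1⟩ := h
  refine ⟨by simpa [add_assoc] using hx.snoc_zero, fun a' c' h => ?_, ?_⟩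
  · rw [snoc_zero_formula hx]
    simp [snocDual_snoc, bas, h0 a' (c' - 1) (by omega)]
  · rw [snoc_zero_formula hx]
    simp [snocDual_snoc, bas, h1]

/-- Here the `bas 0` coordinate sees only the term in which one `e` has acted on the last factor, so
the exponent of `e` moves up by one. -/
theorem Separates.one_zero {a b c : ℤ} {x : TE d} {lam : TE d →ₗ[Qv] Qv}
    (h : Separates d a b c x lam) :
    Separates (d + 1) (a + 1) b c (snoc x (bas 1)) (snocDual lam 0) := by
  obtain ⟨hx, h0, h1⟩ := h
  refine ⟨hx.snoc_one, fun a' c' h => ?_, ?_⟩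
  · rw [snoc_one_formula hx]
    simp [snocDual_snoc, bas, h0 (a' - 1) c' (by omega)]
  · rw [snoc_one_formula hx]
    simp [snocDual_snoc, bas, h1, zpow_ne_zero, v_ne_zero]

theorem Separates.one_one {a b c : ℤ} {x : TE d} {lam : TE d →ₗ[Qv] Qv}
    (h : Separates d a b c x lam) :
    Separates (d + 1) a b c (snoc x (bas 1)) (snocDual lam 1) := by
  obtain ⟨hx, h0, h1⟩ := h
  refine ⟨hx.snoc_one, fun a' c' h => ?_, ?_⟩
  · rw [snoc_one_formula hx]
    simp [snocDual_snoc, bas, h0 a' c' h]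
  · rw [snoc_one_formula hx]
    simp [snocDual_snoc, bas, h1, zpow_ne_zero, v_ne_zero]

/-- If there is slack in `a + b + c ≤ d + 1`, a last factor `bas 1` detected by `bas 1` uses it up.
Otherwise one of `a`, `b`, `c` is positive, and the last factor accounts for one unit of it. -/
theorem exists_separates (d a b c : ℕ) (h : a + b + c ≤ d) : ∃ x lam, Separates d a b c x lam := by
  induction d generalizing a b c with
  | zero =>
    obtain ⟨rfl, rfl, rfl⟩ : a = 0 ∧ b = 0 ∧ c = 0 := by omega
    let φ : TE 0 ≃ₗ[Qv] Qv := TE.equiv 0 ≪≫ₗ PiTensorProduct.isEmptyEquiv (Fin 0)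
    have he : Uq.counit Uq.e = 0 := counit_gen .e
    have hf : Uq.counit Uq.f = 0 := counit_gen .f
    have hK : Uq.counit (Uq.K1 : Uq) = 1 := counit_gen .K1
    have hz : ∀ (u : Uq) (n : ℤ), Uq.counit u = 0 → n ≠ 0 → Uq.counit (zp u n) = 0 := by
      intro u n hu hn
      rw [zp]
      split_ifs with h0
      · exact map_zero _
      · rw [divPow, map_smul, map_pow, hu, zero_pow (by omega), smul_zero]
    refine ⟨φ.symm 1, φ.toLinearMap, ?_, fun a' c' h => ?_, ?_⟩
    · rw [IsWeight, rhoPow_zero_apply, hK]; simp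
    · rw [rhoPow_zero_apply, rhoPow_zero_apply]
      rcases h with h | h
      · rw [hz _ a' he (by simpa using h.ne)]; simp
      · rw [hz _ c' hf (by simpa using h.ne)]; simp
    · simp
  | succ d ih =>
    by_cases hle : a + b + c ≤ d
    · obtain ⟨x, lam, hx⟩ := ih a b c hle
      exact ⟨_, _, hx.one_one⟩
    rcases a.eq_zero_or_pos with rfl | ha
    · rcases b.eq_zero_or_pos with rfl | hb
      · obtain ⟨c, rfl⟩ : ∃ c', c = c' + 1 := ⟨c - 1, by omega⟩
        obtain ⟨x, lam, hx⟩ := ih 0 0 c (by omega)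
        exact ⟨_, _, hx.zero_one⟩
      · obtain ⟨b, rfl⟩ : ∃ b', b = b' + 1 := ⟨b - 1, by omega⟩
        obtain ⟨x, lam, hx⟩ := ih 0 b c (by omega)
        exact ⟨_, _, hx.zero_zero⟩
    · obtain ⟨a, rfl⟩ : ∃ a', a = a' + 1 := ⟨a - 1, by omega⟩
      obtain ⟨x, lam, hx⟩ := ih a b c (by omega)
      exact ⟨_, _, hx.one_zero⟩

end Separation

/-! ### Linear independence -/

section Independence

variable {d : ℕ}

theorem Sv.K1_apply (x : TE d) :
    ((Sv.K1 d : Sv d) : Module.End Qv (TE d)) x = rhoPow d (Uq.K1 : Uq) x := rfl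

theorem Sv.wt_apply_of_ne {m j : ℤ} {x : TE d} (hx : IsWeight d j x) (hm : m ≠ j) :
    ((wt d (Sv.K1 d) (Sv.K2 d) m : Sv d) : Module.End Qv (TE d)) x = 0 := by
  have h := Sv.schurDatum d
  have h1 := h.mul_wt (x := (Sv.K1 d : Sv d)) (s := 0) (by simp) m
  rw [add_zero, h.K1_mul_wt] at h1
  have h2 := congrArg (fun y : Sv d => (y : Module.End Qv (TE d)) x) h1
  simp only [Subalgebra.coe_mul, Subalgebra.coe_smul, LinearMap.smul_apply,
    Module.End.mul_apply, Sv.K1_apply] at h2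
  rw [hx, map_smul, ← sub_eq_zero, ← sub_smul] at h2
  refine (smul_eq_zero.1 h2).resolve_left fun h3 => hm (v_zpow_injective (sub_eq_zero.1 h3))

theorem Sv.wt_apply_self {b : ℕ} (hb : b ≤ d) {x : TE d} (hx : IsWeight d b x) :
    ((wt d (Sv.K1 d) (Sv.K2 d) b : Sv d) : Module.End Qv (TE d)) x = x := by
  have h1 := congrArg (fun y : Sv d => (y : Module.End Qv (TE d)) x) (Sv.schurDatum d).sum_wt
  simp only [AddSubmonoidClass.coe_finsetSum, LinearMap.sum_apply, Subalgebra.coe_one,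
    Module.End.one_apply] at h1
  rw [Finset.sum_eq_single b] at h1
  · exact h1
  · intro j _ hj
    exact Sv.wt_apply_of_ne hx (by exact_mod_cast hj)
  · intro h
    exact absurd (Finset.mem_range.2 (by omega)) h

theorem Sv.zp_e_apply (n : ℤ) : zp (Sv.e d) n = Sv.proj d (zp Uq.e n) := by
  rw [zp, zp]
  split_ifs
  · rw [map_zero]
  · rw [map_divPow]; rfl

theorem Sv.zp_f_apply (n : ℤ) : zp (Sv.f d) n = Sv.proj d (zp Uq.f n) := by
  rw [zp, zp]
  split_ifs
  · rw [map_zero]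
  · rw [map_divPow]; rfl

theorem Sv.monomial_apply {a b b' c : ℕ} (h : b + b' = d) (x : TE d) :
    ((monomial (Sv.e d) (Sv.f d) (Sv.K1 d) (Sv.K2 d) (a, b, b', c) : Sv d) :
      Module.End Qv (TE d)) x = rhoPow d (zp Uq.e a)
        (((wt d (Sv.K1 d) (Sv.K2 d) b : Sv d) : Module.End Qv (TE d))
          (rhoPow d (zp Uq.f c) x)) := by
  rw [SchurDatum.monomial_eq _ _ _ _ h, Sv.zp_e_apply, Sv.zp_f_apply]
  rfl

/-- Among the monomials with nonzero coefficient take one with `a + c` maximal and evaluate the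
relation at its separating pair. Any other monomial in the relation has the wrong weight or a
smaller exponent of `e` or `f`. -/
theorem Sv.linearIndependent_monomial (d : ℕ) : LinearIndependent Qv fun p : Idx1 d =>
    monomial (Sv.e d) (Sv.f d) (Sv.K1 d) (Sv.K2 d) p := by
  classical
  rw [linearIndependent_iff']
  intro s g hg
  by_contra! hne
  obtain ⟨p₀, hp₀, hgp₀⟩ := hne
  obtain ⟨p, hp, hmax⟩ := Finset.exists_max_image (s.filter fun p => g p ≠ 0)
    (fun p => p.1.1 + p.1.2.2.2) ⟨p₀, Finset.mem_filter.2 ⟨hp₀, hgp₀⟩⟩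
  rw [Finset.mem_filter] at hp
  obtain ⟨⟨⟨a, b, b', c⟩, hb, hd⟩, rfl⟩ : ∃ q, q = p := ⟨p, rfl⟩
  dsimp only at hb hd hmax
  obtain ⟨x, lam, hx, h0, h1⟩ := exists_separates d a b c hd
  have h2 := congrArg (fun y : Sv d => lam ((y : Module.End Qv (TE d)) x)) hg
  simp only [AddSubmonoidClass.coe_finsetSum, LinearMap.sum_apply, Subalgebra.coe_smul,
    LinearMap.smul_apply, map_sum, map_smul, Subalgebra.coe_zero, LinearMap.zero_apply,
    map_zero] at h2
  rw [Finset.sum_eq_single_of_mem _ hp.1] at h2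
  · rw [Sv.monomial_apply hb, Sv.wt_apply_self (by omega) (by simpa using hx.zp_f c)] at h2
    exact (mul_ne_zero hp.2 h1) h2
  · rintro ⟨⟨a₁, b₁, b₁', c₁⟩, hb₁, hd₁⟩ hq hqp
    by_cases hgq : g ⟨(a₁, b₁, b₁', c₁), hb₁, hd₁⟩ = 0
    · rw [hgq, zero_smul]
    have hle := hmax _ (Finset.mem_filter.2 ⟨hq, hgq⟩)
    dsimp only at hb₁ hd₁ hle
    rw [Sv.monomial_apply hb₁]
    by_cases hw : (b₁ : ℤ) = b + c - c₁
    · rw [Sv.wt_apply_self (by omega) (by rw [hw]; exact hx.zp_f c₁)]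
      by_cases hlt : (a₁ : ℤ) < a ∨ (c₁ : ℤ) < c
      · rw [h0 _ _ hlt, smul_zero]
      · refine absurd ?_ hqp
        -- Both exponents are at least `a` and `c`, and their sum is at most `a + c` by maximality.
        -- The weight equation then fixes `b₁`, and `b₁ + b₁' = d` fixes `b₁'`.
        obtain ⟨rfl, rfl, rfl, rfl⟩ : a₁ = a ∧ b₁ = b ∧ b₁' = b' ∧ c₁ = c := by omega
        rfl
    · rw [Sv.wt_apply_of_ne (hx.zp_f c₁) hw, map_zero, map_zero, smul_zero]

end Independence

/-! ### Generators -/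

theorem adjoin_range_mkAlgHom {X : Type} (r : FreeAlgebra Qv X → FreeAlgebra Qv X → Prop) :
    Algebra.adjoin Qv (Set.range fun x => RingQuot.mkAlgHom Qv r (FreeAlgebra.ι Qv x)) = ⊤ := by
  rw [show (fun x => RingQuot.mkAlgHom Qv r (FreeAlgebra.ι Qv x)) =
    RingQuot.mkAlgHom Qv r ∘ FreeAlgebra.ι Qv from rfl, Set.range_comp, ← AlgHom.map_adjoin,
    FreeAlgebra.adjoin_range_ι, Algebra.map_top, AlgHom.range_eq_top]
  exact RingQuot.mkAlgHom_surjective Qv r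

theorem Uq.adjoin_eq_top : Algebra.adjoin Qv ({Uq.e, Uq.f, (Uq.K1 : Uq), ((Uq.K1⁻¹ : Uqˣ) : Uq),
    (Uq.K2 : Uq), ((Uq.K2⁻¹ : Uqˣ) : Uq)} : Set Uq) = ⊤ := by
  rw [eq_top_iff, ← adjoin_range_mkAlgHom URel]
  refine Algebra.adjoin_mono ?_
  rintro _ ⟨g, rfl⟩
  cases g
  · exact .inl rfl
  · exact .inr (.inl rfl)
  · exact .inr (.inr (.inl rfl))
  · exact .inr (.inr (.inr (.inl rfl)))
  · exact .inr (.inr (.inr (.inr (.inl rfl))))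
  · exact .inr (.inr (.inr (.inr (.inr rfl))))

theorem Sv.adjoin_eq_top (d : ℕ) : Algebra.adjoin Qv ({Sv.e d, Sv.f d, (Sv.K1 d : Sv d),
    (((Sv.K1 d)⁻¹ : (Sv d)ˣ) : Sv d), (Sv.K2 d : Sv d), (((Sv.K2 d)⁻¹ : (Sv d)ˣ) : Sv d)} :
      Set (Sv d)) = ⊤ := by
  have h := congrArg (Subalgebra.map (Sv.proj d)) Uq.adjoin_eq_top
  have hs : (Sv.proj d).range = ⊤ :=
    (AlgHom.range_eq_top _).2 (AlgHom.rangeRestrict_surjective (rhoPow d))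
  rw [AlgHom.map_adjoin, Algebra.map_top, hs] at h
  simp only [Set.image_insert_eq, Set.image_singleton] at h
  exact h

/-! ### Bases of the integral form -/

section Bases

variable (d : ℕ)

theorem Sv.SA_eq : Sv.SA d = SchurDatum.fullIntForm (Sv.e d) (Sv.f d) (Sv.K1 d) (Sv.K2 d) :=
  map_fullIntForm (Sv.proj d) Uq.e Uq.f Uq.K1 Uq.K2

theorem Sv.toSubmodule_SA : Subalgebra.toSubmodule (Sv.SA d) =
    Submodule.span LaurentZ (Set.range fun p : Idx1 d =>
      monomial (Sv.e d) (Sv.f d) (Sv.K1 d) (Sv.K2 d) p) := by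
  rw [Sv.SA_eq]
  exact (Sv.schurDatum d).fullIntForm_eq_monomialSpan

theorem range_monomial_idxSwap : (Set.range fun p : Idx2 d =>
      monomial (Sv.f d) (Sv.e d) (Sv.K1 d) (Sv.K2 d) p) =
    Set.range fun p : Idx1 d => monomial (Sv.f d) (Sv.e d) (Sv.K2 d) (Sv.K1 d) p := by
  rw [← (SchurDatum.idxSwap d).surjective.range_comp]
  congr 1
  funext p
  exact ((Sv.schurDatum d).monomial_idxSwap p).symm

theorem Sv.toSubmodule_SA' : Subalgebra.toSubmodule (Sv.SA d) =
    Submodule.span LaurentZ (Set.range fun p : Idx2 d =>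
      monomial (Sv.f d) (Sv.e d) (Sv.K1 d) (Sv.K2 d) p) := by
  rw [Sv.SA_eq, range_monomial_idxSwap, ← SchurDatum.fullIntForm_swap]
  exact (Sv.schurDatum d).swap.fullIntForm_eq_monomialSpan

theorem Sv.span_monomial : Submodule.span Qv (Set.range fun p : Idx1 d =>
    monomial (Sv.e d) (Sv.f d) (Sv.K1 d) (Sv.K2 d) p) = ⊤ :=
  (Sv.schurDatum d).span_monomial_eq_top (Sv.adjoin_eq_top d)

theorem Sv.span_monomial' : Submodule.span Qv (Set.range fun p : Idx2 d =>
    monomial (Sv.f d) (Sv.e d) (Sv.K1 d) (Sv.K2 d) p) = ⊤ := by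
  rw [range_monomial_idxSwap]
  refine (Sv.schurDatum d).swap.span_monomial_eq_top ?_
  rw [← Sv.adjoin_eq_top d]
  congr 1
  ext x
  simp only [Set.mem_insert_iff, Set.mem_singleton_iff]
  tauto

instance : Finite (Idx1 d) := by
  refine Set.Finite.to_subtype (Set.Finite.subset
    (((Set.finite_Iic d).prod ((Set.finite_Iic d).prod
      ((Set.finite_Iic d).prod (Set.finite_Iic d))))) ?_)
  rintro ⟨a, b, b', c⟩ ⟨h1, h2⟩
  dsimp only at h1 h2
  simp only [Set.mem_prod, Set.mem_Iic]
  omega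

/-- This family spans and is indexed by a set in bijection with `Idx1 d`, whose size is the
dimension by the first basis. -/
theorem Sv.linearIndependent_monomial' : LinearIndependent Qv fun p : Idx2 d =>
    monomial (Sv.f d) (Sv.e d) (Sv.K1 d) (Sv.K2 d) p := by
  have := Fintype.ofFinite (Idx1 d)
  have := Fintype.ofEquiv _ (SchurDatum.idxSwap d).symm
  refine linearIndependent_of_top_le_span_of_card_eq_finrank (Sv.span_monomial' d).ge ?_
  rw [Fintype.card_congr (SchurDatum.idxSwap d), Module.finrank_eq_card_basis
    (Module.Basis.mk (Sv.linearIndependent_monomial d) (Sv.span_monomial d).ge)]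

theorem exists_basis_of_span {ι : Type*} {m : ι → Sv d} (hm : LinearIndependent Qv m)
    {S : Subalgebra LaurentZ (Sv d)}
    (hS : Subalgebra.toSubmodule S = Submodule.span LaurentZ (Set.range m)) :
    ∃ b : Module.Basis ι LaurentZ S, ∀ i, (b i : Sv d) = m i := by
  have hm' : LinearIndependent LaurentZ m := by
    refine hm.restrict_scalars ?_
    intro x y hxy
    refine IsFractionRing.injective LaurentZ Qv ?_
    simpa [Algebra.smul_def] using hxy
  refine ⟨(Module.Basis.span hm').map (LinearEquiv.ofEq _ _ hS.symm), fun i => ?_⟩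
  rw [Module.Basis.map_apply]
  change ((Module.Basis.span hm' i : _) : Sv d) = m i
  rw [Module.Basis.span_apply]

end Bases

/-! ### Presentations -/

section Presentations

variable {d : ℕ}

/-- Injectivity needs no independence in `B`: the monomials span `B`, and their images are linearly
independent in `Sv d`. -/
theorem bijective_of_schurDatum {B : Type*} [Ring B] [Algebra Qv B] [Algebra LaurentZ B]
    [IsScalarTower LaurentZ Qv B] {e f : B} {K1 K2 : Bˣ} (h : SchurDatum d e f K1 K2)
    (hgen : Algebra.adjoin Qv ({e, f, (K1 : B), ((K1⁻¹ : Bˣ) : B), (K2 : B), ((K2⁻¹ : Bˣ) : B)} :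
      Set B) = ⊤) (φ : B →ₐ[Qv] Sv d) (he : φ e = Sv.e d) (hf : φ f = Sv.f d)
    (hK1 : Units.map (φ : B →* Sv d) K1 = Sv.K1 d) (hK2 : Units.map (φ : B →* Sv d) K2 = Sv.K2 d) :
    Function.Bijective φ := by
  constructor
  · rw [injective_iff_map_eq_zero]
    intro x hx
    have hmem : x ∈ Submodule.span Qv (Set.range fun p : Idx1 d => monomial e f K1 K2 p) := by
      rw [h.span_monomial_eq_top hgen]; trivial
    obtain ⟨c, rfl⟩ := (Finsupp.mem_span_range_iff_exists_finsupp).1 hmem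
    simp only [Finsupp.sum, map_sum, map_smul, map_monomial, he, hf, hK1, hK2] at hx
    have hc : c = 0 := linearIndependent_iff.1 (Sv.linearIndependent_monomial d) c hx
    rw [hc, Finsupp.sum_zero_index]
  · rw [← AlgHom.range_eq_top, eq_top_iff, ← Sv.adjoin_eq_top d, Algebra.adjoin_le_iff]
    rintro x (rfl | rfl | rfl | rfl | rfl | rfl)
    · exact ⟨e, he⟩
    · exact ⟨f, hf⟩
    · exact ⟨K1, congrArg Units.val hK1⟩
    · exact ⟨(K1⁻¹ : Bˣ), congrArg (fun k : (Sv d)ˣ => ((k⁻¹ : (Sv d)ˣ) : Sv d)) hK1⟩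
    · exact ⟨K2, congrArg Units.val hK2⟩
    · exact ⟨(K2⁻¹ : Bˣ), congrArg (fun k : (Sv d)ˣ => ((k⁻¹ : (Sv d)ˣ) : Sv d)) hK2⟩

section

variable {B : Type*} [Ring B] [Algebra Qv B] {e f : B}

/-- With `K₂ = v ^ d k⁻¹`, the relations for `K₂` follow from those for `k`, and the product
relation gives the weight decomposition. The second presentation is the case `k = K₂` with `e` and
`f` exchanged. -/
theorem schurDatum_of_relations {k : Bˣ} (he : (k : B) * e * ((k⁻¹ : Bˣ) : B) = v • e)
    (hf : (k : B) * f * ((k⁻¹ : Bˣ) : B) = v⁻¹ • f)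
    (hef : e * f - f * e =
      (v - v⁻¹)⁻¹ • ((v ^ d)⁻¹ • (k : B) ^ 2 - v ^ d • ((k⁻¹ : Bˣ) : B) ^ 2))
    (hmin : ((List.range (d + 1)).map fun i => (k : B) - algebraMap Qv B (v ^ i)).prod = 0) :
    SchurDatum d e f k (Units.map (algebraMap Qv B : Qv →* B) (vUnit ^ d) * k⁻¹) := by
  have hK2 : ((Units.map (algebraMap Qv B : Qv →* B) (vUnit ^ d) * k⁻¹ : Bˣ) : B) =
      v ^ d • ((k⁻¹ : Bˣ) : B) := by
    simp [vUnit, Algebra.smul_def]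
  have hK2' : (((Units.map (algebraMap Qv B : Qv →* B) (vUnit ^ d) * k⁻¹)⁻¹ : Bˣ) : B) =
      (v ^ d)⁻¹ • (k : B) := by
    refine Units.inv_eq_of_mul_eq_one_left ?_
    rw [hK2, smul_mul_smul_comm, inv_mul_cancel₀ (pow_ne_zero _ v_ne_zero), one_smul,
      Units.mul_inv]
  have he' : (k : B) * e = v • (e * k) := by
    rw [Units.mul_inv_eq_iff_eq_mul] at he
    rw [he, smul_mul_assoc]
  have hf' : (k : B) * f = v⁻¹ • (f * k) := by
    rw [Units.mul_inv_eq_iff_eq_mul] at hf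
    rw [hf, smul_mul_assoc]
  have hinv : ∀ {x : B} {q : Qv}, q ≠ 0 → (k : B) * x = q • (x * k) →
      ((k⁻¹ : Bˣ) : B) * x = q⁻¹ • (x * ((k⁻¹ : Bˣ) : B)) := by
    intro x q hq hx
    rw [Units.inv_mul_eq_iff_eq_mul, mul_smul_comm, ← mul_assoc, hx, smul_mul_assoc, smul_smul,
      inv_mul_cancel₀ hq, one_smul, Units.mul_inv_cancel_right]
  refine ⟨?_, he', hf', ?_, ?_, ?_, exists_decomp_of_minpoly hmin⟩
  · rw [hK2, mul_smul_comm, Units.mul_inv, Algebra.algebraMap_eq_smul_one]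
  · rw [hK2, smul_mul_assoc, hinv v_ne_zero he', mul_smul_comm, smul_comm]
  · rw [hK2, smul_mul_assoc, hinv (inv_ne_zero v_ne_zero) hf', mul_smul_comm, smul_comm, inv_inv]
  · rw [hef, hK2, hK2', mul_smul_comm, mul_smul_comm, sq, sq]

variable {K1 K2 : Bˣ}

theorem SchurDatum.e_f_K1 (h : SchurDatum d e f K1 K2) : e * f - f * e =
    (v - v⁻¹)⁻¹ • ((v ^ d)⁻¹ • (K1 : B) ^ 2 - v ^ d • ((K1⁻¹ : Bˣ) : B) ^ 2) := by
  have h2 : (K2 : B) = v ^ d • ((K1⁻¹ : Bˣ) : B) := by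
    rw [h.K1_inv_eq, smul_smul, zpow_neg, zpow_natCast,
      mul_inv_cancel₀ (pow_ne_zero _ v_ne_zero), one_smul]
  rw [h.e_f, h.swap.K1_inv_eq, h2, mul_smul_comm, mul_smul_comm, sq, sq, zpow_neg, zpow_natCast]

theorem SchurDatum.conj_e (h : SchurDatum d e f K1 K2) :
    (K1 : B) * e * ((K1⁻¹ : Bˣ) : B) = v • e := by
  rw [h.K1_e, smul_mul_assoc, Units.mul_inv_cancel_right]

theorem SchurDatum.conj_f (h : SchurDatum d e f K1 K2) :
    (K1 : B) * f * ((K1⁻¹ : Bˣ) : B) = v⁻¹ • f := by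
  rw [h.K1_f, smul_mul_assoc, Units.mul_inv_cancel_right]

/-- The map from the generators of a presented algebra to an algebra. -/
def genMap (e f : B) (k : Bˣ) : PGen → B
  | .e => e
  | .f => f
  | .K => k
  | .K' => ((k⁻¹ : Bˣ) : B)

theorem lift_minpoly (e f : B) (k : Bˣ) :
    FreeAlgebra.lift Qv (genMap e f k) ((List.range (d + 1)).map fun i =>
      FreeAlgebra.ι Qv PGen.K - algebraMap Qv _ (v ^ i)).prod =
    ((List.range (d + 1)).map fun i => (k : B) - algebraMap Qv B (v ^ i)).prod := by
  rw [map_list_prod, List.map_map]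
  congr 2
  funext i
  simp only [Function.comp_apply, map_sub, FreeAlgebra.lift_ι_apply, AlgHom.commutes, genMap]

theorem SchurDatum.respects_P1Rel (h : SchurDatum d e f K1 K2) ⦃x y : FreeAlgebra Qv PGen⦄
    (hxy : P1Rel d x y) : FreeAlgebra.lift Qv (genMap e f K1) x =
      FreeAlgebra.lift Qv (genMap e f K1) y := by
  cases hxy with
  | minpoly => rw [lift_minpoly, h.minpoly, map_zero]
  | mul_inv => simp [genMap]
  | inv_mul => simp [genMap]
  | K_e => simpa [genMap] using h.conj_e
  | K_f => simpa [genMap] using h.conj_f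
  | e_f => simpa only [map_sub, map_mul, map_smul, map_pow, FreeAlgebra.lift_ι_apply, genMap]
      using h.e_f_K1

theorem SchurDatum.respects_P2Rel (h : SchurDatum d e f K1 K2) ⦃x y : FreeAlgebra Qv PGen⦄
    (hxy : P2Rel d x y) : FreeAlgebra.lift Qv (genMap e f K2) x =
      FreeAlgebra.lift Qv (genMap e f K2) y := by
  cases hxy with
  | minpoly => rw [lift_minpoly, h.swap.minpoly, map_zero]
  | mul_inv => simp [genMap]
  | inv_mul => simp [genMap]
  | K_e => simpa [genMap] using h.swap.conj_f
  | K_f => simpa [genMap] using h.swap.conj_e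
  | e_f =>
    simp only [map_sub, map_mul, map_smul, map_pow, FreeAlgebra.lift_ι_apply, genMap]
    rw [← neg_sub, h.swap.e_f_K1, ← smul_neg, neg_sub]

end

variable (d)

theorem P1.schurDatum : SchurDatum d (P1.e d) (P1.f d) (P1.K1 d) (P1.K2 d) := by
  refine schurDatum_of_relations ?_ ?_ ?_ ?_
  · have h := RingQuot.mkAlgHom_rel Qv (P1Rel.K_e (d := d))
    simp only [map_mul, map_smul] at h
    exact h
  · have h := RingQuot.mkAlgHom_rel Qv (P1Rel.K_f (d := d))
    simp only [map_mul, map_smul] at h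
    exact h
  · have h := RingQuot.mkAlgHom_rel Qv (P1Rel.e_f (d := d))
    simp only [map_mul, map_sub, map_smul, map_pow] at h
    exact h
  · have h := RingQuot.mkAlgHom_rel Qv (P1Rel.minpoly (d := d))
    rw [map_list_prod, List.map_map, map_zero] at h
    rw [← h]
    congr 2
    funext i
    rw [Function.comp_apply, map_sub, AlgHom.commutes]
    rfl

theorem P2.schurDatum : SchurDatum d (P2.e d) (P2.f d) (P2.K1 d) (P2.K2 d) := by
  refine (schurDatum_of_relations ?_ ?_ ?_ ?_).swap
  · have h := RingQuot.mkAlgHom_rel Qv (P2Rel.K_f (d := d))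
    simp only [map_mul, map_smul] at h
    exact h
  · have h := RingQuot.mkAlgHom_rel Qv (P2Rel.K_e (d := d))
    simp only [map_mul, map_smul] at h
    exact h
  · have h := RingQuot.mkAlgHom_rel Qv (P2Rel.e_f (d := d))
    simp only [map_mul, map_sub, map_smul, map_pow] at h
    rw [← neg_sub, ← neg_sub (_ • _), smul_neg, neg_inj]
    exact h
  · have h := RingQuot.mkAlgHom_rel Qv (P2Rel.minpoly (d := d))
    rw [map_list_prod, List.map_map, map_zero] at h
    rw [← h]
    congr 2
    funext i
    rw [Function.comp_apply, map_sub, AlgHom.commutes]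
    rfl

theorem P1.adjoin_eq_top : Algebra.adjoin Qv ({P1.e d, P1.f d, (P1.K1 d : P1 d),
    (((P1.K1 d)⁻¹ : (P1 d)ˣ) : P1 d), (P1.K2 d : P1 d), (((P1.K2 d)⁻¹ : (P1 d)ˣ) : P1 d)} :
      Set (P1 d)) = ⊤ := by
  rw [eq_top_iff, ← adjoin_range_mkAlgHom (P1Rel d)]
  refine Algebra.adjoin_mono ?_
  rintro _ ⟨g, rfl⟩
  cases g
  · exact .inl rfl
  · exact .inr (.inl rfl)
  · exact .inr (.inr (.inl rfl))
  · exact .inr (.inr (.inr (.inl rfl)))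

theorem P2.adjoin_eq_top : Algebra.adjoin Qv ({P2.e d, P2.f d, (P2.K1 d : P2 d),
    (((P2.K1 d)⁻¹ : (P2 d)ˣ) : P2 d), (P2.K2 d : P2 d), (((P2.K2 d)⁻¹ : (P2 d)ˣ) : P2 d)} :
      Set (P2 d)) = ⊤ := by
  rw [eq_top_iff, ← adjoin_range_mkAlgHom (P2Rel d)]
  refine Algebra.adjoin_mono ?_
  rintro _ ⟨g, rfl⟩
  cases g
  · exact .inl rfl
  · exact .inr (.inl rfl)
  · exact .inr (.inr (.inr (.inr (.inl rfl))))
  · exact .inr (.inr (.inr (.inr (.inr rfl))))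

/-- The canonical map from the first presented algebra to the Schur algebra. -/
def P1.toSv : P1 d →ₐ[Qv] Sv d :=
  RingQuot.liftAlgHom Qv ⟨FreeAlgebra.lift Qv (genMap (Sv.e d) (Sv.f d) (Sv.K1 d)),
    (Sv.schurDatum d).respects_P1Rel⟩

/-- The canonical map from the second presented algebra to the Schur algebra. -/
def P2.toSv : P2 d →ₐ[Qv] Sv d :=
  RingQuot.liftAlgHom Qv ⟨FreeAlgebra.lift Qv (genMap (Sv.e d) (Sv.f d) (Sv.K2 d)),
    (Sv.schurDatum d).respects_P2Rel⟩

theorem P1.toSv_gen (g : PGen) :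
    P1.toSv d (P1.gen d g) = genMap (Sv.e d) (Sv.f d) (Sv.K1 d) g := by
  simp [P1.toSv, P1.gen]

theorem P2.toSv_gen (g : PGen) :
    P2.toSv d (P2.gen d g) = genMap (Sv.e d) (Sv.f d) (Sv.K2 d) g := by
  simp [P2.toSv, P2.gen]

variable {d}

/-- In a Schur datum, `K₁` determines `K₂`. -/
theorem SchurDatum.K2_unique {B C : Type*} [Ring B] [Algebra Qv B] [Ring C] [Algebra Qv C]
    {e f : B} {K1 K2 : Bˣ} {e' f' : C} {K1' K2' : Cˣ} (h : SchurDatum d e f K1 K2)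
    (h' : SchurDatum d e' f' K1' K2') (φ : B →ₐ[Qv] C)
    (hK : Units.map (φ : B →* C) K1 = K1') : Units.map (φ : B →* C) K2 = K2' := by
  subst hK
  refine mul_left_cancel (a := Units.map (φ : B →* C) K1) (Units.ext ?_)
  rw [← map_mul, Units.val_mul _ K2', h'.mul_eq, Units.coe_map, Units.val_mul, h.mul_eq]
  exact φ.commutes _

/-- A Schur datum whose generators generate gives a model of the Schur algebra. -/
theorem exists_algEquiv {B : Type*} [Ring B] [Algebra Qv B] [Algebra LaurentZ B]
    [IsScalarTower LaurentZ Qv B] {e f : B} {K1 K2 : Bˣ} (h : SchurDatum d e f K1 K2)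
    (hgen : Algebra.adjoin Qv ({e, f, (K1 : B), ((K1⁻¹ : Bˣ) : B), (K2 : B), ((K2⁻¹ : Bˣ) : B)} :
      Set B) = ⊤) (φ : B →ₐ[Qv] Sv d) (he : φ e = Sv.e d) (hf : φ f = Sv.f d)
    (hK1 : Units.map (φ : B →* Sv d) K1 = Sv.K1 d) (hK2 : Units.map (φ : B →* Sv d) K2 = Sv.K2 d) :
    ∃ φ : B ≃ₐ[Qv] Sv d, φ e = Sv.e d ∧ φ f = Sv.f d ∧ φ K1 = Sv.K1 d ∧ φ K2 = Sv.K2 d ∧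
      (intForm e f K1).map (φ.toAlgHom.restrictScalars LaurentZ) = Sv.SA d ∧
      (intForm e f K2).map (φ.toAlgHom.restrictScalars LaurentZ) = Sv.SA d := by
  have hb := bijective_of_schurDatum h hgen φ he hf hK1 hK2
  have hφ : (AlgEquiv.ofBijective φ hb).toAlgHom = φ := AlgHom.ext fun _ => rfl
  refine ⟨AlgEquiv.ofBijective φ hb, he, hf, congrArg Units.val hK1, congrArg Units.val hK2,
    ?_, ?_⟩
  · rw [hφ, map_intForm, he, hf, hK1, (Sv.schurDatum d).intForm_K1_eq, Sv.SA_eq]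
  · rw [hφ, map_intForm, he, hf, hK2, (Sv.schurDatum d).intForm_K2_eq, Sv.SA_eq]

end Presentations

end QSchur

end

open QSchur in
theorem theorem2p4 (d : ℕ) :
    (Sv.SA d = intForm (Sv.e d) (Sv.f d) (Sv.K1 d) ∧
      Sv.SA d = intForm (Sv.e d) (Sv.f d) (Sv.K2 d)) ∧
    (∃ b : Module.Basis (Idx1 d) LaurentZ (Sv.SA d), ∀ p : Idx1 d,
      (b p : Sv d) = monomial (Sv.e d) (Sv.f d) (Sv.K1 d) (Sv.K2 d) p) ∧
    (∃ b : Module.Basis (Idx2 d) LaurentZ (Sv.SA d), ∀ p : Idx2 d,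
      (b p : Sv d) = monomial (Sv.f d) (Sv.e d) (Sv.K1 d) (Sv.K2 d) p) ∧
    (∃ φ : P1 d ≃ₐ[Qv] Sv d,
      φ (P1.e d) = Sv.e d ∧ φ (P1.f d) = Sv.f d ∧
      φ (P1.K1 d) = Sv.K1 d ∧ φ (P1.K2 d) = Sv.K2 d ∧
      (intForm (P1.e d) (P1.f d) (P1.K1 d)).map (φ.toAlgHom.restrictScalars LaurentZ) = Sv.SA d ∧
      (intForm (P1.e d) (P1.f d) (P1.K2 d)).map (φ.toAlgHom.restrictScalars LaurentZ) = Sv.SA d) ∧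
    (∃ φ : P2 d ≃ₐ[Qv] Sv d,
      φ (P2.e d) = Sv.e d ∧ φ (P2.f d) = Sv.f d ∧
      φ (P2.K1 d) = Sv.K1 d ∧ φ (P2.K2 d) = Sv.K2 d ∧
      (intForm (P2.e d) (P2.f d) (P2.K1 d)).map (φ.toAlgHom.restrictScalars LaurentZ) = Sv.SA d ∧
      (intForm (P2.e d) (P2.f d) (P2.K2 d)).map (φ.toAlgHom.restrictScalars LaurentZ) = Sv.SA d) := by
  have h := Sv.schurDatum d
  refine ⟨⟨?_, ?_⟩, exists_basis_of_span d (Sv.linearIndependent_monomial d) (Sv.toSubmodule_SA d),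
    exists_basis_of_span d (Sv.linearIndependent_monomial' d) (Sv.toSubmodule_SA' d), ?_, ?_⟩
  · rw [Sv.SA_eq, h.intForm_K1_eq]
  · rw [Sv.SA_eq, h.intForm_K2_eq]
  · have hK : Units.map (P1.toSv d : P1 d →* Sv d) (P1.K1 d) = Sv.K1 d :=
      Units.ext (P1.toSv_gen d .K)
    exact exists_algEquiv (P1.schurDatum d) (P1.adjoin_eq_top d) (P1.toSv d) (P1.toSv_gen d .e)
      (P1.toSv_gen d .f) hK ((P1.schurDatum d).K2_unique h _ hK)
  · have hK : Units.map (P2.toSv d : P2 d →* Sv d) (P2.K2 d) = Sv.K2 d :=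
      Units.ext (P2.toSv_gen d .K)
    exact exists_algEquiv (P2.schurDatum d) (P2.adjoin_eq_top d) (P2.toSv d) (P2.toSv_gen d .e)
      (P2.toSv_gen d .f) ((P2.schurDatum d).swap.K2_unique h.swap _ hK) hK
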